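/- Let $\mathbb{K}$ be a field of characteristic zero and let $D$ be any set. **The natural Hopf algebra.** Let $\mathcal{S}_D := \{\alpha_{d,n} : d \in D, n \in \mathbb{N}\}$ be the signature where $\alpha_{d,n}$ has arity $n$. An $\mathcal{S}_D$-term is either the leaf $\perp$ or a generator of arity $n$ with an ordered sequence of $n$ subterms; terms form the free operad $\mathfrak{T}\mathcal{S}_D$, with unit $\perp$, where $y[z_1,\dots,z_m]$ is obtained by grafting $z_1,\dots,z_m$ onto the $m=\mathrm{ar}(y)$ leaves of $y$. A forest is a word of terms, $\mathrm{rd}(w)$ is the word obtained from $w$ by deleting its letters $\perp$, and $w$ is reduced if $\mathrm{rd}(w)=w$. Let $\mathbf{N}\mathfrak{T}\mathcal{S}_D$ be the $\mathbb{K}$-space with basis $(\mathsf{E}_f)$ indexed by reduced forests, with product $\mathsf{E}_f \mathsf{E}_{f'} = \mathsf{E}_{ff'}$, with the coproduct that is the algebra morphism such that $$\Delta \mathsf{E}_x = \sum_{x = y[z_1,\dots,z_{\mathrm{ar}(y)}]} \mathsf{E}_{\mathrm{rd}(y)} \otimes \mathsf{E}_{\mathrm{rd}(z_1 \cdots z_{\mathrm{ar}(y)})}$$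 for any term $x \neq \perp$, and with counit $\mathsf{E}_f \mapsto [f = \epsilon]$. **Realizations.** For an alphabet $A$, let $\mathbb{K}\langle A\rangle$ be the algebra of noncommutative polynomials on $A$ of finite degree and possibly infinite support. An $\mathcal{S}_D$-forest-like alphabet is a set $A$ with unary relations $\mathrm{R}$ and $\mathrm{D}_{\alpha_{d,n}}$ and binary relations $\prec_j$, $j \geq 1$. The disjoint sum $A' \mathbin{+\!\!+} A''$ is $A' \sqcup A''$ with the relations of $A'$ and of $A''$ and, in addition, $a' \prec_j a''$ for all $j$, $a' \in A'$, and $a'' \in \mathrm{R}''$. For a reduced forest $f$, whose internal nodes are numbered in left to right preorder, $\mathsf{r}_A(\mathsf{E}_f)$ is the sum of all words $w$ on $A$ whose length is the number of internal nodes of $f$ and such that $w_i \in \mathrm{R}$ if $i$ is a root, $w_i \in \mathrm{D}_{g}$ if $i$ is decorated by $g$, and $w_i \prec_j w_{i'}$ if $i'$ is the $j$-th child of $i$. Let $\mathbb{A}_{D,\mathbb{N}} := \{\mathbf{a}_{d,i} : d \in D, i \in \mathbb{N}\}$ be the alphabet such that all letters are in $\mathrm{R}$, $\mathrm{D}_{\alpha_{d,n}}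 = \{\mathbf{a}_{d,i} : i \in \mathbb{N}\}$, and $\mathbf{a}_{d,i} \prec_j \mathbf{a}_{d',i'}$ if and only if $i < i'$. **Foissy's Hopf algebra.** $\mathbf{NCK}_D$ is the $\mathbb{K}$-space with basis $(\mathsf{E}_F)$ indexed by $D$-decorated planar forests (words of nonempty planar rooted trees with nodes decorated on $D$), with concatenation as product, with the coproduct that is the algebra morphism such that $\Delta \mathsf{E}_t = \sum_c \mathsf{E}_{P^c(t)} \otimes \mathsf{E}_{R^c(t)}$ for any tree $t$, where $c$ runs over all admissible cuts of $t$ (the empty and the total cut included), $P^c(t)$ is the pruned forest, and $R^c(t)$ is the remaining trunk, and with counit $\mathsf{E}_F \mapsto [F = \epsilon]$. Let $\Delta^{\mathrm{op}}$ be $\Delta$ followed by the exchange of the two tensor factors. For a forest $F$, let $\widehat{F}$ be the reduced $\mathcal{S}_D$-forest obtained by replacing each node decorated by $d$ and having $n$ children by $\alpha_{d,n}$, and for any $\mathcal{S}_D$-forest-like alphabet $A$, let $\bar{\mathsf{r}}_A : \mathbf{NCK}_D \to \mathbb{K}\langle A\rangle$ be the linear map such that $\bar{\mathsf{r}}_A(\mathsf{E}_F)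 = \mathsf{r}_A(\mathsf{E}_{\widehat{F}})$. **Theorem.** 1. $\mathbf{N}\mathfrak{T}\mathcal{S}_D$ and $\mathbf{NCK}_D$ are Hopf algebras. 2. The map $\mathsf{r}_{\mathbb{A}_{D,\mathbb{N}}} : \mathbf{N}\mathfrak{T}\mathcal{S}_D \to \mathbb{K}\langle \mathbb{A}_{D,\mathbb{N}} \rangle$ is an algebra morphism, and its image $\mathsf{r}_{\mathbb{A}_{D,\mathbb{N}}}(\mathbf{N}\mathfrak{T}\mathcal{S}_D)$ has a (necessarily unique) Hopf algebra structure such that $\mathsf{r}_{\mathbb{A}_{D,\mathbb{N}}}$ is a Hopf algebra morphism onto it. This Hopf algebra is isomorphic to $\mathbf{NCK}_D$. Moreover, $\bar{\mathsf{r}}_{\mathbb{A}_{D,\mathbb{N}}}$ is an isomorphism from $\mathbf{NCK}_D$, with the coproduct $\Delta^{\mathrm{op}}$, to this Hopf algebra. 3. This gives a polynomial realization of $\mathbf{NCK}_D$. Precisely, let $\mathcal{A}$ be the class of the $\mathcal{S}_D$-forest-like alphabets such that $\mathrm{D}_{\alpha_{d,n}}$ does not depend on $n$ and $\prec_j$ does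 not depend on $j$. This class contains $\mathbb{A}_{D,\mathbb{N}}$ and is closed under $\mathbin{+\!\!+}$, which is associative. For any $A \in \mathcal{A}$, the map $\bar{\mathsf{r}}_A$ sends forests with $n$ nodes to homogeneous polynomials of degree $n$. For any $A, A' \in \mathcal{A}$ and $x \in \mathbf{NCK}_D$, $$\theta_{A,A'}\bigl(\bar{\mathsf{r}}_{A \mathbin{+\!\!+} A'}(x)\bigr) = (\bar{\mathsf{r}}_A \otimes \bar{\mathsf{r}}_{A'})(\Delta^{\mathrm{op}} x),$$ where $\theta_{A,A'}$ sends each word on $A \sqcup A'$ to the tensor product of its restrictions to $A$ and to $A'$. Finally, $\bar{\mathsf{r}}_{\mathbb{A}_{D,\mathbb{N}}}$ is injective. All this also holds when $\Delta^{\mathrm{op}}$ is replaced by $\Delta$ and $A \mathbin{+\!\!+} A'$ is replaced by $A' \mathbin{+\!\!+} A$. -/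

import Mathlib

open scoped TensorProduct

universe u v w

noncomputable section

namespace ForestHopf

/-! ## Hopf algebras -/

/-- The comultiplication and counit carried by the algebra `A` make it a Hopf algebra over `K`. -/
structure IsHopf (K : Type v) (A : Type w) [Field K] [Ring A] [Algebra K A]
    [CoalgebraStruct K A] : Prop where
  coassoc : (TensorProduct.assoc K A A A).toLinearMap ∘ₗ
      (CoalgebraStruct.comul (R := K) (A := A)).rTensor A ∘ₗ CoalgebraStruct.comul =
    (CoalgebraStruct.comul (R := K) (A := A)).lTensor A ∘ₗ CoalgebraStruct.comul
  rTensor_counit : (CoalgebraStruct.counit (R := K) (A := A)).rTensor A ∘ₗ CoalgebraStruct.comul =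
    TensorProduct.mk K K A 1
  lTensor_counit : (CoalgebraStruct.counit (R := K) (A := A)).lTensor A ∘ₗ CoalgebraStruct.comul =
    (TensorProduct.mk K A K).flip 1
  counit_one : CoalgebraStruct.counit (R := K) (1 : A) = 1
  counit_mul : ∀ a b : A, CoalgebraStruct.counit (R := K) (a * b) =
    CoalgebraStruct.counit (R := K) a * CoalgebraStruct.counit (R := K) b
  comul_one : CoalgebraStruct.comul (R := K) (1 : A) = 1
  comul_mul : ∀ a b : A, CoalgebraStruct.comul (R := K) (a * b) =
    CoalgebraStruct.comul (R := K) a * CoalgebraStruct.comul (R := K) b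
  antipode : ∃ S : A →ₗ[K] A,
    LinearMap.mul' K A ∘ₗ S.rTensor A ∘ₗ CoalgebraStruct.comul =
      Algebra.linearMap K A ∘ₗ CoalgebraStruct.counit ∧
    LinearMap.mul' K A ∘ₗ S.lTensor A ∘ₗ CoalgebraStruct.comul =
      Algebra.linearMap K A ∘ₗ CoalgebraStruct.counit

/-- `IsHopf` is Mathlib's notion of Hopf algebra, for the given operations. -/
@[reducible] def IsHopf.toHopfAlgebra {K : Type v} {A : Type w} [Field K] [Ring A]
    [alg : Algebra K A] [co : CoalgebraStruct K A] (h : IsHopf K A) : HopfAlgebra K A :=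
  { alg, co with
    coassoc := h.coassoc
    rTensor_counit_comp_comul := h.rTensor_counit
    lTensor_counit_comp_comul := h.lTensor_counit
    counit_one := h.counit_one
    mul_compr₂_counit := by ext a b; exact h.counit_mul a b
    comul_one := h.comul_one
    mul_compr₂_comul := by ext a b; exact h.comul_mul a b
    antipode := h.antipode.choose
    mul_antipode_rTensor_comul := h.antipode.choose_spec.1
    mul_antipode_lTensor_comul := h.antipode.choose_spec.2 }

/-! ## Noncommutative polynomials with possibly infinite support -/

/-- Noncommutative formal series on the alphabet `A`: arbitrary families of coefficients indexed
by words, with the concatenation (Cauchy) product. -/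
def NCSeries (K : Type v) (A : Type u) : Type (max u v) := List A → K

namespace NCSeries

variable {K : Type v} {A : Type u} [Field K]

instance : AddCommGroup (NCSeries K A) := inferInstanceAs (AddCommGroup (List A → K))
instance : Module K (NCSeries K A) := inferInstanceAs (Module K (List A → K))

instance : One (NCSeries K A) := ⟨fun w => match w with | [] => 1 | _ :: _ => 0⟩

/-- `(f g)(w)` is the sum of `f(u) g(u')` over all factorizations `w = u u'`. -/
instance : Mul (NCSeries K A) :=
  ⟨fun f g w => ∑ i ∈ Finset.range (w.length + 1), f (w.take i) * g (w.drop i)⟩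

theorem mul_apply (f g : NCSeries K A) (w : List A) :
    (f * g) w = ∑ i ∈ Finset.range (w.length + 1), f (w.take i) * g (w.drop i) := rfl

theorem add_apply (f g : NCSeries K A) (w : List A) : (f + g) w = f w + g w := rfl

theorem smul_apply (k : K) (f : NCSeries K A) (w : List A) : (k • f) w = k * f w := rfl

theorem mul_nil (f g : NCSeries K A) : (f * g) [] = f [] * g [] := by simp [mul_apply]

/-- The series of the coefficients of the words starting with `a`. -/
def quot (f : NCSeries K A) (a : A) : NCSeries K A := fun u => f (a :: u)

theorem mul_cons (f g : NCSeries K A) (a : A) (w : List A) :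
    (f * g) (a :: w) = (f.quot a * g) w + f [] * g (a :: w) := by
  simp only [mul_apply, List.length_cons]
  rw [Finset.sum_range_succ']
  simp [quot]

theorem mul_assoc_apply (w : List A) : ∀ f g h : NCSeries K A,
    ((f * g) * h) w = (f * (g * h)) w := by
  induction w with
  | nil => intro f g h; simp only [mul_nil]; ring
  | cons a w ih =>
    intro f g h
    have key : (f * g).quot a = f.quot a * g + f [] • g.quot a :=
      funext fun u => mul_cons f g a u
    have dist : ∀ x y z : NCSeries K A, ((x + y) * z) w = (x * z) w + (y * z) w := by
      intro x y z
      simp only [mul_apply, add_apply, add_mul, Finset.sum_add_distrib]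
    have sm : ∀ (k : K) (x y : NCSeries K A), ((k • x) * y) w = k * (x * y) w := by
      intro k x y
      simp only [mul_apply, smul_apply, Finset.mul_sum, mul_assoc]
    rw [mul_cons, key, dist, sm, ih, mul_cons f (g * h), mul_cons g h, mul_nil]
    ring

theorem one_mul' (f : NCSeries K A) : 1 * f = f := by
  funext w
  cases w with
  | nil => rw [mul_nil]; exact one_mul _
  | cons a w =>
    rw [mul_cons]
    have h1 : ((1 : NCSeries K A).quot a * f) w = 0 := by
      rw [mul_apply]
      exact Finset.sum_eq_zero fun i _ => zero_mul _
    rw [h1, zero_add]; exact one_mul _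

theorem mul_one' (f : NCSeries K A) : f * 1 = f := by
  suffices H : ∀ (w : List A) (f : NCSeries K A), (f * 1) w = f w from funext fun w => H w f
  intro w
  induction w with
  | nil => intro f; rw [mul_nil]; exact mul_one _
  | cons a w ih =>
    intro f
    rw [mul_cons, ih]
    have : (1 : NCSeries K A) (a :: w) = 0 := rfl
    rw [this, mul_zero, add_zero]
    rfl

instance : Ring (NCSeries K A) :=
  { (inferInstance : AddCommGroup (NCSeries K A)) with
    mul := (· * ·)
    one := 1
    mul_assoc := fun f g h => funext fun w => mul_assoc_apply w f g h
    one_mul := one_mul'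
    mul_one := mul_one'
    zero_mul := fun f => funext fun w => Finset.sum_eq_zero fun i _ => zero_mul _
    mul_zero := fun f => funext fun w => Finset.sum_eq_zero fun i _ => mul_zero _
    left_distrib := fun f g h => funext fun w => by
      simp only [mul_apply, add_apply, mul_add, Finset.sum_add_distrib]
    right_distrib := fun f g h => funext fun w => by
      simp only [mul_apply, add_apply, add_mul, Finset.sum_add_distrib] }

instance : Algebra K (NCSeries K A) :=
  Algebra.ofModule
    (fun k f g => funext fun w => by
      simp only [mul_apply, smul_apply, Finset.mul_sum, mul_assoc])
    (fun k f g => funext fun w => by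
      simp only [mul_apply, smul_apply, Finset.mul_sum, mul_left_comm])

end NCSeries

/-- The algebra of `A`-polynomials: series of finite degree, possibly with infinite support. -/
def NCPoly (K : Type v) (A : Type u) [Field K] : Subalgebra K (NCSeries K A) where
  carrier := {f | ∃ n : ℕ, ∀ w : List A, n < w.length → f w = 0}
  mul_mem' := by
    rintro f g ⟨m, hf⟩ ⟨n, hg⟩
    refine ⟨m + n, fun w hw => Finset.sum_eq_zero fun i hi => ?_⟩
    have hi' : i ≤ w.length := Nat.lt_succ_iff.mp (Finset.mem_range.mp hi)
    by_cases h : m < i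
    · rw [hf (w.take i) (by rw [List.length_take]; omega), zero_mul]
    · rw [hg (w.drop i) (by rw [List.length_drop]; omega), mul_zero]
  add_mem' := by
    rintro f g ⟨m, hf⟩ ⟨n, hg⟩
    refine ⟨m + n, fun w hw => ?_⟩
    rw [NCSeries.add_apply, hf w (by omega), hg w (by omega), add_zero]
  algebraMap_mem' := by
    intro k
    refine ⟨0, fun w hw => ?_⟩
    rw [Algebra.algebraMap_eq_smul_one, NCSeries.smul_apply]
    cases w with
    | nil => exact absurd hw (lt_irrefl _)
    | cons a w => exact mul_zero k

/-- The coefficient of a word in a polynomial. -/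
def NCPoly.coeff {K : Type v} {A : Type u} [Field K] (f : NCPoly K A) (w : List A) : K := f.1 w

/-- Homogeneous polynomials of degree `n`. -/
def NCPoly.IsHomogeneous {K : Type v} {A : Type u} [Field K] (f : NCPoly K A) (n : ℕ) : Prop :=
  ∀ w : List A, NCPoly.coeff f w ≠ 0 → w.length = n

/-- The evaluation of `K⟨A⟩ ⊗ K⟨A'⟩` as families of coefficients indexed by pairs of words. -/
def evalTensor {K : Type v} {A A' : Type u} [Field K] :
    (NCPoly K A ⊗[K] NCPoly K A') →ₗ[K] (List A × List A' → K) :=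
  TensorProduct.lift
    (LinearMap.mk₂ K (fun f g p => NCPoly.coeff f p.1 * NCPoly.coeff g p.2)
      (fun _ _ _ => funext fun _ => add_mul _ _ _)
      (fun _ _ _ => funext fun _ => mul_assoc _ _ _)
      (fun _ _ _ => funext fun _ => mul_add _ _ _)
      (fun _ _ _ => funext fun _ => mul_left_comm _ _ _))

/-- `K⟨A⟩ ⊗ K⟨A'⟩` is thereby a subspace of the space of families of coefficients indexed by pairs
of words. -/
theorem evalTensor_injective {K : Type v} {A A' : Type u} [Field K] :
    Function.Injective (evalTensor (K := K) (A := A) (A' := A')) := by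
  classical
  rw [injective_iff_map_eq_zero]
  intro t ht
  let b := Module.Basis.ofVectorSpace K (NCPoly K A)
  let e := TensorProduct.equivFinsuppOfBasisLeft (N := NCPoly K A') b
  obtain ⟨F, rfl⟩ := e.symm.surjective t
  suffices F = 0 by rw [this, map_zero]
  change evalTensor ((TensorProduct.equivFinsuppOfBasisLeft b).symm F) = 0 at ht
  rw [TensorProduct.equivFinsuppOfBasisLeft_symm_apply] at ht
  have hv : ∀ v : List A', ∑ i ∈ F.support, NCPoly.coeff (F i) v • b i = 0 := by
    intro v
    apply Subtype.ext
    funext u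
    have h := congrFun ht (u, v)
    rw [Finsupp.sum, map_sum, Finset.sum_apply] at h
    rw [AddSubmonoidClass.coe_finsetSum]
    refine Eq.trans ?_ h
    refine (Finset.sum_apply u _ (fun i => (NCPoly.coeff (F i) v • b i).1)).trans ?_
    exact Finset.sum_congr rfl fun i _ => mul_comm _ _
  ext1 i
  by_cases hi : i ∈ F.support
  · apply Subtype.ext
    funext v
    exact linearIndependent_iff'.mp b.linearIndependent F.support _ (hv v) i hi
  · simpa using hi

/-- The subword made of the letters of the first summand. -/
def leftPart {A A' : Type u} (w : List (A ⊕ A')) : List A := w.filterMap Sum.getLeft?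

/-- The subword made of the letters of the second summand. -/
def rightPart {A A' : Type u} (w : List (A ⊕ A')) : List A' := w.filterMap Sum.getRight?

/-- Only finitely many words have given restrictions to the two summands. -/
theorem finite_restrictions {A A' : Type u} (p : List A × List A') :
    {w : List (A ⊕ A') | leftPart w = p.1 ∧ rightPart w = p.2}.Finite := by
  suffices H : ∀ (n : ℕ) (p : List A × List A'), p.1.length + p.2.length = n →
      {w : List (A ⊕ A') | leftPart w = p.1 ∧ rightPart w = p.2}.Finite from H _ p rfl
  intro n
  induction n with
  | zero =>
    rintro ⟨u, v⟩ h
    refine (Set.finite_singleton []).subset ?_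
    rintro w ⟨h1, h2⟩
    have hu : u = [] := List.length_eq_zero_iff.mp (by simp at h; simpa using h.1)
    have hv : v = [] := List.length_eq_zero_iff.mp (by simp at h; simpa using h.2)
    subst hu hv
    cases w with
    | nil => rfl
    | cons x w => cases x <;> simp [leftPart, rightPart] at h1 h2
  | succ n ih =>
    rintro ⟨u, v⟩ h
    have hL : (⋃ a ∈ {a | a ∈ u}, (List.cons (Sum.inl a : A ⊕ A')) ''
        {w | leftPart w = u.tail ∧ rightPart w = v}).Finite := by
      refine Set.Finite.biUnion u.finite_toSet fun a ha => Set.Finite.image _ (ih (u.tail, v) ?_)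
      have := List.length_pos_of_mem ha
      simp at h ⊢; omega
    have hR : (⋃ a ∈ {a | a ∈ v}, (List.cons (Sum.inr a : A ⊕ A')) ''
        {w | leftPart w = u ∧ rightPart w = v.tail}).Finite := by
      refine Set.Finite.biUnion v.finite_toSet fun a ha => Set.Finite.image _ (ih (u, v.tail) ?_)
      have := List.length_pos_of_mem ha
      simp at h ⊢; omega
    refine (hL.union hR).subset ?_
    rintro w ⟨h1, h2⟩
    cases w with
    | nil => simp [leftPart, rightPart] at h1 h2; subst h1 h2; simp at h
    | cons x w =>
      cases x with
      | inl a =>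
        left
        simp only [leftPart, rightPart, List.filterMap_cons, Sum.getLeft?_inl,
          Sum.getRight?_inl] at h1 h2
        subst h1 h2
        simp [leftPart, rightPart]
      | inr a =>
        right
        simp only [leftPart, rightPart, List.filterMap_cons, Sum.getLeft?_inr,
          Sum.getRight?_inr] at h1 h2
        subst h1 h2
        simp [leftPart, rightPart]

/-- The alphabet-splitting map, which sends a word `w` on `A ⊔ A'` to the tensor product of its
restrictions to `A` and to `A'`. As polynomials may have infinite support, its values are read as
families of coefficients indexed by pairs of words. The sum is finite by `finite_restrictions`. -/
def theta {K : Type v} {A A' : Type u} [Field K] (f : NCPoly K (A ⊕ A')) : List A × List A' → K :=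
  fun p => ∑ w ∈ (finite_restrictions p).toFinset, NCPoly.coeff f w

/-! ## Terms, free operads, and their natural Hopf algebras -/

/-- Terms on the signature `S`, where `S n` is the set of generators of arity `n`. -/
inductive Term (S : ℕ → Type u) : Type u
  | leaf : Term S
  | node (n : ℕ) (g : S n) (c : Fin n → Term S) : Term S

namespace Term

variable {S : ℕ → Type u}

/-- The arity of a term in the free operad: its number of leaves. -/
def ar : Term S → ℕ
  | leaf => 1
  | node _ _ c => ∑ i, ar (c i)

/-- The degree of a term: its number of internal nodes. -/
def dg : Term S → ℕ
  | leaf => 0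
  | node _ _ c => 1 + ∑ i, dg (c i)

/-- The number of leaves of the subterms on the left of the `i`-th subterm. -/
def leafPos {n : ℕ} (c : Fin n → Term S) (i : Fin n) : ℕ := ∑ k ∈ Finset.Iio i, ar (c k)

/-- Full composition of the free operad, whose unit is `leaf`: for a word `z` of length `ar y`,
`comp y z` grafts the root of the `k`-th letter of `z` onto the `k`-th leaf of `y`. (It is not used
for words of other lengths.) -/
def comp : Term S → List (Term S) → Term S
  | leaf, z => z.headD leaf
  | node n g c, z => node n g fun i => comp (c i) ((z.drop (leafPos c i)).take (ar (c i)))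

open Classical in
/-- The finite set of all pairs `(y, z)`, where `y` is a term and `z` is a word of `ar y` terms,
such that `x = y[z 1, …, z (ar y)]`, see `mem_factorizations`. -/
def factorizations : Term S → Finset (Term S × List (Term S))
  | leaf => {(leaf, [leaf])}
  | node n g c => insert (leaf, [node n g c])
      ((Fintype.piFinset fun i => factorizations (c i)).image fun p =>
        (node n g fun i => (p i).1, (List.ofFn fun i => (p i).2).flatten))

theorem slice_flatten {α : Type u} {n : ℕ} (l : Fin n → List α) (i : Fin n) :
    ((List.ofFn l).flatten.drop (∑ k ∈ Finset.Iio i, (l k).length)).take (l i).length = l i := by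
  induction n with
  | zero => exact i.elim0
  | succ n ih =>
    rw [List.ofFn_succ, List.flatten_cons]
    refine Fin.cases ?_ (fun i => ?_) i
    · have : Finset.Iio (0 : Fin (n + 1)) = ∅ := by ext k; simp
      simp [this]
    · have : Finset.Iio i.succ = insert 0 ((Finset.Iio i).map (Fin.succEmb n)) := by
        ext k
        refine Fin.cases ?_ (fun k => ?_) k <;> simp
      rw [this, Finset.sum_insert (by simp), Finset.sum_map, ← List.drop_drop,
        List.drop_left]
      exact ih (fun j => l j.succ) i

theorem flatten_slices {α : Type u} {n : ℕ} (m : Fin n → ℕ) (z : List α)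
    (hz : z.length = ∑ i, m i) :
    (List.ofFn fun i => (z.drop (∑ k ∈ Finset.Iio i, m k)).take (m i)).flatten = z := by
  induction n generalizing z with
  | zero => simp at hz; simp [hz]
  | succ n ih =>
    rw [List.ofFn_succ, List.flatten_cons]
    have h0 : Finset.Iio (0 : Fin (n + 1)) = ∅ := by ext k; simp
    have hs : ∀ i : Fin n, ∑ k ∈ Finset.Iio i.succ, m k =
        m 0 + ∑ k ∈ Finset.Iio i, m k.succ := by
      intro i
      have : Finset.Iio i.succ = insert 0 ((Finset.Iio i).map (Fin.succEmb n)) := by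
        ext k
        refine Fin.cases ?_ (fun k => ?_) k <;> simp
      rw [this, Finset.sum_insert (by simp), Finset.sum_map]
      rfl
    rw [Fin.sum_univ_succ] at hz
    have := ih (fun i => m i.succ) (z.drop (m 0)) (by rw [List.length_drop]; omega)
    simp only [h0, Finset.sum_empty, List.drop_zero, hs, ← List.drop_drop]
    rw [this, List.take_append_drop]

theorem mem_factorizations (x : Term S) (y : Term S) (z : List (Term S)) :
    (y, z) ∈ factorizations x ↔ z.length = ar y ∧ comp y z = x := by
  have hleaf : ∀ (z : List (Term S)) (x : Term S),
      (z.length = ar (leaf : Term S) ∧ comp leaf z = x) ↔ z = [x] := by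
    intro z x
    constructor
    · rintro ⟨h1, h2⟩
      obtain ⟨t, rfl⟩ := List.length_eq_one_iff.mp h1
      simpa [comp] using h2
    · rintro rfl
      exact ⟨rfl, rfl⟩
  induction x generalizing y z with
  | leaf =>
    cases y with
    | leaf => rw [hleaf]; simp [factorizations]
    | node n g c => simp [factorizations, comp]
  | node n g c ih =>
    cases y with
    | leaf => rw [hleaf]; simp [factorizations]
    | node m h d =>
      simp only [factorizations, Finset.mem_insert, Finset.mem_image, Fintype.mem_piFinset,
        Prod.mk.injEq, reduceCtorEq, false_and, false_or, comp, ar]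
      constructor
      · rintro ⟨q, hq, hqe, rfl⟩
        simp only [node.injEq] at hqe
        obtain ⟨rfl, h3, h4⟩ := hqe
        obtain rfl := eq_of_heq h3
        obtain rfl := eq_of_heq h4
        have hq' := fun i => (ih i (q i).1 (q i).2).mp (hq i)
        refine ⟨?_, ?_⟩
        · rw [List.length_flatten, List.map_ofFn, List.sum_ofFn]
          exact Finset.sum_congr rfl fun i _ => (hq' i).1
        · congr 1
          funext i
          have := slice_flatten (fun i => (q i).2) i
          simp only [(hq' _).1] at this
          rw [leafPos, this, (hq' i).2]
      · rintro ⟨hl, he⟩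
        simp only [node.injEq] at he
        obtain ⟨rfl, h3, h4⟩ := he
        obtain rfl := eq_of_heq h3
        have h5 := eq_of_heq h4
        refine ⟨fun i => (d i, (z.drop (leafPos d i)).take (ar (d i))), fun i => ?_, rfl,
          flatten_slices (fun i => ar (d i)) z hl⟩
        refine (ih i _ _).mpr ?_
        refine ⟨?_, congrFun h5 i⟩
        have := congrArg List.length (flatten_slices (fun i => ar (d i)) z hl)
        rw [List.length_take, List.length_drop, min_eq_left]
        have hsub : ∑ k ∈ insert i (Finset.Iio i), ar (d k) ≤ ∑ k, ar (d k) :=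
          Finset.sum_le_sum_of_subset (Finset.subset_univ _)
        rw [Finset.sum_insert (by simp)] at hsub
        rw [leafPos]
        omega

/-- The decorations of the internal nodes, in left to right preorder. -/
def decs : Term S → List (Σ n, S n)
  | leaf => []
  | node n g c => ⟨n, g⟩ :: (List.ofFn fun i => decs (c i)).flatten

/-- The preorder position (starting from `0`, the position of the root) at which the internal nodes
of the `i`-th subterm start. -/
def childPos {n : ℕ} (c : Fin n → Term S) (i : Fin n) : ℕ := 1 + ∑ k ∈ Finset.Iio i, dg (c k)

/-- `t.Edge j a b`: in `t`, the internal node `b` is the `j`-th child of the internal node `a`.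
Internal nodes are identified with their preorder positions; positions and `j` start from `0`. -/
def Edge : Term S → ℕ → ℕ → ℕ → Prop
  | leaf, _, _, _ => False
  | node n _ c, j, a, b =>
      (∃ i : Fin n, i.val = j ∧ c i ≠ leaf ∧ a = 0 ∧ b = childPos c i) ∨
      ∃ (i : Fin n) (a' b' : ℕ), Edge (c i) j a' b' ∧ a = childPos c i + a' ∧ b = childPos c i + b'

end Term

/-- Terms different from the unit of the free operad. -/
abbrev ProperTerm (S : ℕ → Type u) : Type u := {t : Term S // t ≠ Term.leaf}

/-- Reduced forests: words on the terms different from the unit. -/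
abbrev RForest (S : ℕ → Type u) : Type u := FreeMonoid (ProperTerm S)

open Classical in
/-- The reduction of a word of terms: the subword of its letters different from the unit. -/
def rd {S : ℕ → Type u} (l : List (Term S)) : RForest S :=
  FreeMonoid.ofList (l.filterMap fun t => if h : t ≠ Term.leaf then some ⟨t, h⟩ else none)

namespace RForest

variable {S : ℕ → Type u}

/-- The underlying word of terms. -/
def terms (f : RForest S) : List (Term S) := f.toList.map Subtype.val

/-- The degree: the total number of internal nodes. -/
def dg (f : RForest S) : ℕ := (f.terms.map Term.dg).sum

/-- The decorations of the internal nodes, in preorder. -/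
def decs (f : RForest S) : List (Σ n, S n) := f.terms.flatMap Term.decs

/-- The preorder position (from `0`) at which the internal nodes of the `k`-th term start. -/
def pos (f : RForest S) (k : ℕ) : ℕ := ((f.terms.take k).map Term.dg).sum

/-- The internal node `a` is a root. -/
def IsRoot (f : RForest S) (a : ℕ) : Prop := ∃ k, k < f.terms.length ∧ a = f.pos k

/-- The internal node `b` is the `j`-th child of the internal node `a` (everything from `0`). -/
def Edge (f : RForest S) (j a b : ℕ) : Prop :=
  ∃ (k : ℕ) (t : Term S) (a' b' : ℕ), f.terms[k]? = some t ∧ t.Edge j a' b' ∧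
    a = f.pos k + a' ∧ b = f.pos k + b'

end RForest

/-- The vector space with elementary basis indexed by reduced forests on `S`; its product is the
concatenation of reduced forests. With the operations below, it is the natural Hopf algebra of the
free operad on `S`. -/
def NatHopf (K : Type v) (S : ℕ → Type u) [Field K] : Type (max u v) := MonoidAlgebra K (RForest S)

namespace NatHopf

variable (K : Type v) (S : ℕ → Type u) [Field K]

instance : Ring (NatHopf K S) := inferInstanceAs (Ring (MonoidAlgebra K (RForest S)))
instance : Algebra K (NatHopf K S) := inferInstanceAs (Algebra K (MonoidAlgebra K (RForest S)))

/-- The elementary basis. -/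
def E : Module.Basis (RForest S) K (NatHopf K S) := MonoidAlgebra.basis (RForest S) K

/-- The algebra morphism with given values on the basis elements indexed by one-letter words. -/
def lift {B : Type w} [Ring B] [Algebra K B] (φ : ProperTerm S → B) : NatHopf K S →ₐ[K] B :=
  MonoidAlgebra.lift K B (RForest S) (FreeMonoid.lift φ)

/-- The coproduct is the algebra morphism such that `Δ E_x` is the sum, over all factorizations
`x = y[z 1, …, z (ar y)]`, of `E_{rd y} ⊗ E_{rd z}`. The counit is the coefficient of the empty
forest. -/
instance : CoalgebraStruct K (NatHopf K S) where
  comul := (lift K S fun x =>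
    ∑ p ∈ Term.factorizations x.1, E K S (rd [p.1]) ⊗ₜ[K] E K S (rd p.2)).toLinearMap
  counit := (lift K S fun _ => (0 : K)).toLinearMap

end NatHopf

/-! ## Forest-like alphabets and the realization -/

/-- An `S`-forest-like structure on the alphabet `A`: the root relation, the decoration relations,
and the edge relations, where `edge j` is the relation for the `j`-th child counted from `0`. -/
structure ForestLike (S : ℕ → Type u) (A : Type u) : Type u where
  root : A → Prop
  dec : (n : ℕ) → S n → A → Prop
  edge : ℕ → A → A → Prop

namespace ForestLike

variable {S : ℕ → Type u}

/-- The disjoint sum of two forest-like alphabets. -/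
def sum {A A' : Type u} (B : ForestLike S A) (B' : ForestLike S A') : ForestLike S (A ⊕ A') where
  root x := match x with
    | .inl a => B.root a
    | .inr a => B'.root a
  dec n g x := match x with
    | .inl a => B.dec n g a
    | .inr a => B'.dec n g a
  edge j x y := match x, y with
    | .inl a, .inl b => B.edge j a b
    | .inr a, .inr b => B'.edge j a b
    | .inl _, .inr b => B'.root b
    | .inr _, .inl _ => False

/-- The disjoint sum taken in the opposite order, `B' ++ B`, seen on `A ⊔ A'`. -/
def sumOpp {A A' : Type u} (B : ForestLike S A) (B' : ForestLike S A') : ForestLike S (A ⊕ A') where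
  root x := (B'.sum B).root x.swap
  dec n g x := (B'.sum B).dec n g x.swap
  edge j x y := (B'.sum B).edge j x.swap y.swap

/-- The bijection `e` identifies two forest-like alphabets. -/
structure IsIso {A A' : Type u} (e : A ≃ A') (B : ForestLike S A) (B' : ForestLike S A') :
    Prop where
  root_iff : ∀ a, B.root a ↔ B'.root (e a)
  dec_iff : ∀ n g a, B.dec n g a ↔ B'.dec n g (e a)
  edge_iff : ∀ j a b, B.edge j a b ↔ B'.edge j (e a) (e b)

/-- The word `w` is compatible with the reduced forest `f`. -/
structure Compatible {A : Type u} (B : ForestLike S A) (f : RForest S) (w : List A) : Prop where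
  length_eq : w.length = f.dg
  root : ∀ (i : ℕ) (x : A), w[i]? = some x → f.IsRoot i → B.root x
  dec : ∀ (i : ℕ) (x : A) (n : ℕ) (g : S n),
    w[i]? = some x → f.decs[i]? = some ⟨n, g⟩ → B.dec n g x
  edge : ∀ (j i i' : ℕ) (x x' : A),
    w[i]? = some x → w[i']? = some x' → f.Edge j i i' → B.edge j x x'

variable (K : Type v) [Field K]

open Classical in
/-- The `A`-realization of `f`: the sum of all `f`-compatible words. -/
def forestPoly {A : Type u} (B : ForestLike S A) (f : RForest S) : NCPoly K A :=
  ⟨fun w => if B.Compatible f w then 1 else 0,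
    f.dg, fun _ hw => if_neg fun h => absurd h.length_eq (ne_of_gt hw)⟩

/-- The realization map of the natural Hopf algebra of the free operad on `S`. -/
def realize {A : Type u} (B : ForestLike S A) : NatHopf K S →ₗ[K] NCPoly K A :=
  (NatHopf.E K S).constr K (B.forestPoly K)

end ForestLike

/-- `IsPolynomialRealization Δ gr C s r U`: for the space `H` with coproduct `Δ` and homogeneous
components `gr n`, the class `C` of `S`-forest-like alphabets, with the associative sum operation
`s`, the graded maps `r`, and the alphabet `U`, form a polynomial realization. -/
structure IsPolynomialRealization {K : Type v} [Field K] {S : ℕ → Type u} {H : Type w}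
    [AddCommGroup H] [Module K H] (Δ : H →ₗ[K] H ⊗[K] H) (gr : ℕ → Submodule K H)
    (C : ∀ {A : Type u}, ForestLike S A → Prop)
    (s : ∀ {A A' : Type u}, ForestLike S A → ForestLike S A' → ForestLike S (A ⊕ A'))
    (r : ∀ {A : Type u}, ForestLike S A → H →ₗ[K] NCPoly K A)
    {A₀ : Type u} (U : ForestLike S A₀) : Prop where
  sum_mem : ∀ {A A' : Type u} (B : ForestLike S A) (B' : ForestLike S A'),
    C B → C B' → C (s B B')
  sum_assoc : ∀ {A A' A'' : Type u} (B : ForestLike S A) (B' : ForestLike S A')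
    (B'' : ForestLike S A''), C B → C B' → C B'' →
    ForestLike.IsIso (Equiv.sumAssoc A A' A'') (s (s B B') B'') (s B (s B' B''))
  graded : ∀ {A : Type u} (B : ForestLike S A), C B →
    ∀ n, ∀ x ∈ gr n, NCPoly.IsHomogeneous (r B x) n
  doubling : ∀ {A A' : Type u} (B : ForestLike S A) (B' : ForestLike S A'), C B → C B' →
    ∀ x, theta (r (s B B') x) = evalTensor (TensorProduct.map (r B) (r B') (Δ x))
  mem : C U
  injective : Function.Injective (r U)

/-! ## Decorated planar forests -/

/-- Nonempty planar rooted trees with nodes decorated on `D`: a root decorated by `d` with an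
ordered sequence of `n` subtrees. -/
inductive PTree (D : Type u) : Type u
  | node (d : D) (n : ℕ) (c : Fin n → PTree D) : PTree D

namespace PTree

variable {D : Type u}

/-- The tree with root decorated by `d` and list of subtrees `l`. -/
def graft (d : D) (l : List (PTree D)) : PTree D := node d l.length l.get

/-- The number of nodes. -/
def size : PTree D → ℕ
  | node _ _ c => 1 + ∑ i, size (c i)

/-- Admissible cuts of a tree. Such a cut is either the total cut (`none`), or keeps the root and
then induces an admissible cut of each subtree of the root, where the total cut of a subtree stands
for cutting the edge between the root and this subtree. -/
def Cut : PTree D → Type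
  | node _ n c => Option (∀ i : Fin n, Cut (c i))

/-- There are finitely many admissible cuts. -/
@[reducible] def cutFintype : (t : PTree D) → Fintype (Cut t)
  | node _ n c =>
    letI : ∀ i : Fin n, Fintype (Cut (c i)) := fun i => cutFintype (c i)
    inferInstanceAs (Fintype (Option (∀ i : Fin n, Cut (c i))))

instance (t : PTree D) : Fintype (Cut t) := cutFintype t

/-- The pruned part `P^c(t)`: the forest of the subtrees above the cut, from left to right. -/
def pruned : (t : PTree D) → Cut t → List (PTree D)
  | node d n c, none => [node d n c]
  | node _ _ c, some k => (List.ofFn fun i => pruned (c i) (k i)).flatten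

/-- The trunk `R^c(t)`: the tree containing the root that remains, or the empty forest if the cut
is total. -/
def trunk : (t : PTree D) → Cut t → List (PTree D)
  | node _ _ _, none => []
  | node d _ c, some k => [graft d (List.ofFn fun i => trunk (c i) (k i)).flatten]

end PTree

/-- `D`-decorated planar forests. -/
abbrev PForest (D : Type u) : Type u := FreeMonoid (PTree D)

/-- The number of nodes of a forest. -/
def PForest.size {D : Type u} (F : PForest D) : ℕ := (F.toList.map PTree.size).sum

/-- The vector space with basis indexed by `D`-decorated planar forests; its product is the
concatenation of forests. With the operations below, it is Foissy's Hopf algebra of `D`-decorated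
planar forests. -/
def NCK (K : Type v) (D : Type u) [Field K] : Type (max u v) := MonoidAlgebra K (PForest D)

namespace NCK

variable (K : Type v) (D : Type u) [Field K]

instance : Ring (NCK K D) := inferInstanceAs (Ring (MonoidAlgebra K (PForest D)))
instance : Algebra K (NCK K D) := inferInstanceAs (Algebra K (MonoidAlgebra K (PForest D)))

/-- The basis of forests. -/
def E : Module.Basis (PForest D) K (NCK K D) := MonoidAlgebra.basis (PForest D) K

/-- The algebra morphism with given values on trees. -/
def lift {B : Type w} [Ring B] [Algebra K B] (φ : PTree D → B) : NCK K D →ₐ[K] B :=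
  MonoidAlgebra.lift K B (PForest D) (FreeMonoid.lift φ)

/-- The coproduct is the algebra morphism such that `Δ t` is the sum of `P^c(t) ⊗ R^c(t)` over all
admissible cuts `c` of the tree `t`. The counit is the coefficient of the empty forest. -/
instance : CoalgebraStruct K (NCK K D) where
  comul := (lift K D fun t =>
    ∑ c : PTree.Cut t, E K D (FreeMonoid.ofList (PTree.pruned t c)) ⊗ₜ[K]
      E K D (FreeMonoid.ofList (PTree.trunk t c))).toLinearMap
  counit := (lift K D fun _ => (0 : K)).toLinearMap

/-- The coproduct with its two tensor factors exchanged: on trees, the sum of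
`R^c(t) ⊗ P^c(t)`. -/
def comulOpp : NCK K D →ₗ[K] NCK K D ⊗[K] NCK K D :=
  (TensorProduct.comm K (NCK K D) (NCK K D)).toLinearMap ∘ₗ CoalgebraStruct.comul

/-- The homogeneous component of degree `n`, spanned by the forests with `n` nodes. -/
def component (n : ℕ) : Submodule K (NCK K D) := Submodule.span K (E K D '' {F | F.size = n})

end NCK

/-! ## The realization of decorated planar forests -/

/-- The signature with one generator `α_{d,n}` of arity `n` for all `d` in `D` and all `n`. -/
def sigD (D : Type u) : ℕ → Type u := fun _ => D

/-- The alphabet of the letters `a_{d,i}`: all letters are roots, `a_{d,i}` is decorated by all the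
`α_{d,n}`, and there is a `j`-edge from `a_{d,i}` to `a_{d',i'}` when `i < i'`. -/
def alphD (D : Type u) : ForestLike (sigD D) (D × ℕ) where
  root _ := True
  dec _ d a := a.1 = d
  edge _ a b := a.2 < b.2

/-- The term obtained by replacing each node decorated by `d` and having `n` children by
`α_{d,n}`. -/
def PTree.toTerm {D : Type u} : PTree D → Term (sigD D)
  | node d n c => Term.node n d fun i => toTerm (c i)

theorem PTree.toTerm_ne_leaf {D : Type u} (t : PTree D) : t.toTerm ≠ Term.leaf := by
  cases t; simp [PTree.toTerm]

/-- The forest of terms associated with a decorated planar forest. -/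
def PForest.toRForest {D : Type u} : PForest D →* RForest (sigD D) :=
  FreeMonoid.map fun t => ⟨t.toTerm, t.toTerm_ne_leaf⟩

/-- The realization map of decorated planar forests, `E_F ↦ r_A(E_f)` where `f` is the forest of
terms associated with `F`. -/
def realizeNCK (K : Type v) [Field K] {D : Type u} {A : Type u} (B : ForestLike (sigD D) A) :
    NCK K D →ₗ[K] NCPoly K A :=
  (NCK.E K D).constr K fun F => B.realize K (NatHopf.E K (sigD D) (PForest.toRForest F))

/-- Alphabets whose decoration relations for `α_{d,n}` do not depend on `n` and whose `j`-edge
relations do not depend on `j`. -/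
def IsUniform {D : Type u} {A : Type u} (B : ForestLike (sigD D) A) : Prop :=
  (∀ (d : D) (n n' : ℕ), B.dec n d = B.dec n' d) ∧ ∀ j j' : ℕ, B.edge j = B.edge j'

end ForestHopf

end

open ForestHopf

/-!
Deleting the leaves of terms gives a surjective bialgebra morphism from the natural Hopf algebra to
the coopposite of `NCK K D`: a factorization `x = y[z₁, …, zₘ]` is an admissible cut, whose trunk is
`y` and whose pruned forest is `z₁ ⋯ zₘ` without its leaves. Grafting satisfies a cocycle identity
on both sides, and the algebras are generated by repeated grafting, so coassociativity and the
compatibility of the coproducts follow by induction. The number of nodes makes the augmentation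
locally nilpotent under convolution, so a geometric series provides the antipode, and this property
passes to quotients. In `NCK K D` the mirror of planar forests reverses products but not
coproducts, the antipode reverses both; their composition identifies `NCK K D` with its
coopposite.

On an alphabet whose relations depend neither on arities nor on child positions, the realization of
a term depends only on its underlying planar forest, so it factors through the morphism above. Its
compatibility with the coproduct follows by induction on forests: the first letter of a word
realizes the leftmost root, and removing it leaves a realization of the children of this root whose
root relation is the edge relation of the letter. On `alphD D` the least word realizing a forest
lists the pairs (decoration, depth) of its nodes in preorder. It determines the forest, and every
other word realizing the forest is letterwise larger, so the realization is unitriangular, hence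
injective.
-/

noncomputable section

namespace ForestHopf

/-! ### Conilpotent bialgebras -/

section Convolution

open WithConv Coalgebra Filter

variable {R C A : Type*} [CommRing R] [AddCommGroup C] [Module R C] [Ring A] [Algebra R A]

theorem exists_linearMap_eventually_eq_sum (J : ℕ → C →ₗ[R] A)
    (hJ : ∀ x, ∀ᶠ n in atTop, J n x = 0) :
    ∃ T : C →ₗ[R] A, ∀ x, ∀ᶠ n in atTop, T x = (∑ k ∈ Finset.range n, J k) x := by
  have hsupp : ∀ x, (Function.support fun k => J k x).Finite := fun x => by
    obtain ⟨N, hN⟩ := eventually_atTop.mp (hJ x)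
    exact (Set.finite_lt_nat N).subset fun k hk => lt_of_not_ge fun h => hk (hN k h)
  refine ⟨{ toFun := fun x => ∑ᶠ k, J k x
            map_add' := fun x y => by
              simp only [map_add]; exact finsum_add_distrib (hsupp x) (hsupp y)
            map_smul' := fun r x => by
              simp only [map_smul, RingHom.id_apply]; exact (smul_finsum' r (hsupp x)).symm },
    fun x => ?_⟩
  obtain ⟨N, hN⟩ := eventually_atTop.mp (hJ x)
  filter_upwards [eventually_ge_atTop N] with n hn
  rw [LinearMap.sum_apply]
  exact finsum_eq_sum_of_support_subset _ fun k hk => by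
    simpa using lt_of_not_ge fun h => hk (hN k (hn.trans h))

theorem eventually_tensorMap_eq {M N P Q : Type*} [AddCommGroup M] [Module R M] [AddCommGroup N]
    [Module R N] [AddCommGroup P] [Module R P] [AddCommGroup Q] [Module R Q]
    {f : M →ₗ[R] P} {f' : ℕ → M →ₗ[R] P} {g : N →ₗ[R] Q} {g' : ℕ → N →ₗ[R] Q}
    (hf : ∀ x, ∀ᶠ n in atTop, f x = f' n x) (hg : ∀ y, ∀ᶠ n in atTop, g y = g' n y)
    (z : M ⊗[R] N) :
    ∀ᶠ n in atTop, TensorProduct.map f g z = TensorProduct.map (f' n) (g' n) z := by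
  induction z using TensorProduct.induction_on with
  | zero => simp
  | tmul x y =>
    filter_upwards [hf x, hg y] with n hfx hgy
    rw [TensorProduct.map_tmul, TensorProduct.map_tmul, hfx, hgy]
  | add x y hx hy =>
    filter_upwards [hx, hy] with n hxn hyn
    rw [map_add, map_add, hxn, hyn]

/-- The inverse is the geometric series. -/
theorem isUnit_one_sub_of_locally_nilpotent [Coalgebra R C] (J : WithConv (C →ₗ[R] A))
    (hJ : ∀ x, ∀ᶠ n in atTop, (J ^ n) x = 0) : IsUnit (1 - J) := by
  obtain ⟨T, hT⟩ := exists_linearMap_eventually_eq_sum (fun n => (J ^ n).ofConv) hJ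
  have hJ' : ∀ x, ∀ᶠ _ : ℕ in atTop, (1 - J).ofConv x = (1 - J).ofConv x := by simp
  have hpow : ∀ n x, (J ^ n) x = 0 → (1 - J ^ n) x = (1 : WithConv (C →ₗ[R] A)) x :=
    fun n x h => (congrArg (_ - ·) h).trans (sub_zero _)
  refine ⟨⟨1 - J, toConv T, WithConv.ext (LinearMap.ext fun x => ?_),
    WithConv.ext (LinearMap.ext fun x => ?_)⟩, rfl⟩
  · obtain ⟨n, hn, hJn⟩ := ((eventually_tensorMap_eq hJ' hT (comul x)).and (hJ x)).exists
    rw [← hpow n x hJn, ← mul_neg_geom_sum]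
    rw [LinearMap.convMul_apply, LinearMap.convMul_apply, ofConv_sum]
    exact congrArg _ hn
  · obtain ⟨n, hn, hJn⟩ := ((eventually_tensorMap_eq hT hJ' (comul x)).and (hJ x)).exists
    rw [← hpow n x hJn, ← geom_sum_mul_neg]
    rw [LinearMap.convMul_apply, LinearMap.convMul_apply, ofConv_sum]
    exact congrArg _ hn

end Convolution

section Conilpotent

open WithConv Coalgebra Filter

/-- A bialgebra is conilpotent when `id - η ∘ ε` is locally nilpotent for the convolution product;
the opposite map is used here, so that `id` is `1` minus it. -/
def IsConilpotent (R H : Type*) [CommRing R] [Ring H] [Bialgebra R H] : Prop :=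
  ∀ x : H, ∀ᶠ n in atTop, ((1 - toConv LinearMap.id : WithConv (H →ₗ[R] H)) ^ n) x = 0

variable {R H H' : Type*} [CommRing R] [Ring H] [Ring H'] [Bialgebra R H]

theorem IsConilpotent.of_filtration {ι : Type*} {b : ι → H} (size : ι → ℕ)
    (hspan : Submodule.span R (Set.range b) = ⊤)
    (h0 : ∀ i, size i = 0 → b i = algebraMap R H (counit (R := R) (b i)))
    (hΔ : ∀ i, comul (R := R) (b i) ∈
      Submodule.span R {z | ∃ j k, size j + size k ≤ size i ∧ z = b j ⊗ₜ[R] b k}) :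
    IsConilpotent R H := by
  let J : WithConv (H →ₗ[R] H) := 1 - toConv LinearMap.id
  have hJ0 : ∀ i, size i = 0 → J.ofConv (b i) = 0 := fun i hi => sub_eq_zero.mpr (h0 i hi).symm
  have hJ : ∀ n i, size i < n → (J ^ n).ofConv (b i) = 0 := by
    intro n
    induction n with
    | zero => exact fun i hi => absurd hi (Nat.not_lt_zero _)
    | succ n ih =>
      intro i hi
      suffices hker : Submodule.span R {z | ∃ j k, size j + size k ≤ size i ∧ z = b j ⊗ₜ[R] b k} ≤
          LinearMap.ker (LinearMap.mul' R H ∘ₗ TensorProduct.map J.ofConv (J ^ n).ofConv) by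
        rw [pow_succ']
        exact hker (hΔ i)
      rw [Submodule.span_le]
      rintro _ ⟨j, k, hjk, rfl⟩
      rcases Nat.eq_zero_or_pos (size j) with hj | hj
      · simp [hJ0 j hj]
      · simp [ih k (by omega)]
  intro x
  have hx : x ∈ Submodule.span R (Set.range b) := hspan ▸ Submodule.mem_top
  induction hx using Submodule.span_induction with
  | mem x hx =>
    obtain ⟨i, rfl⟩ := hx
    filter_upwards [eventually_gt_atTop (size i)] with n hn using hJ n i hn
  | zero => exact Eventually.of_forall fun n => map_zero (J ^ n).ofConv
  | add x y _ _ hx hy =>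
    filter_upwards [hx, hy] with n hxn hyn
    exact (map_add (J ^ n).ofConv x y).trans (by rw [hxn, hyn, add_zero])
  | smul r x _ hx =>
    filter_upwards [hx] with n hxn
    exact (map_smul (J ^ n).ofConv r x).trans (by rw [hxn, smul_zero])

theorem IsConilpotent.of_surjective [Bialgebra R H'] (f : H →ₐc[R] H')
    (hf : Function.Surjective f) (hH : IsConilpotent R H) : IsConilpotent R H' := by
  let J : WithConv (H →ₗ[R] H) := 1 - toConv LinearMap.id
  let J' : WithConv (H' →ₗ[R] H') := 1 - toConv LinearMap.id
  let φ : H →ₐ[R] H' := f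
  have hone : (1 : WithConv (H' →ₗ[R] H')).ofConv ∘ₗ φ.toLinearMap =
      φ.toLinearMap ∘ₗ (1 : WithConv (H →ₗ[R] H)).ofConv := by
    ext x
    simpa [φ, LinearMap.convOne_def] using (AlgHomClass.commutes f (counit x)).symm
  have hJ : J'.ofConv ∘ₗ φ.toLinearMap = φ.toLinearMap ∘ₗ J.ofConv := by
    simp only [J, J', ofConv_sub, LinearMap.sub_comp, LinearMap.comp_sub, hone,
      LinearMap.id_comp, LinearMap.comp_id]
  have hpow : ∀ n : ℕ, (J' ^ n).ofConv ∘ₗ φ.toLinearMap = φ.toLinearMap ∘ₗ (J ^ n).ofConv := by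
    intro n
    induction n with
    | zero => simpa only [pow_zero] using hone
    | succ n ih =>
      rw [pow_succ, pow_succ, LinearMap.algHom_comp_convMul_distrib, ← ih, ← hJ]
      exact LinearMap.convMul_comp_coalgHom_distrib (J' ^ n) J' (f : H →ₗc[R] H')
  intro y
  obtain ⟨x, rfl⟩ := hf y
  filter_upwards [hH x] with n hn
  exact (LinearMap.congr_fun (hpow n) x).trans ((congrArg f hn).trans (map_zero f))

/-- The coalgebra structure on a surjective image of a coalgebra. -/
abbrev coalgebraOfSurjective {C C' : Type*} [AddCommGroup C] [Module R C] [Coalgebra R C]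
    [AddCommGroup C'] [Module R C'] [CoalgebraStruct R C'] (f : C →ₗc[R] C')
    (hf : Function.Surjective f) : Coalgebra R C' where
  coassoc := by
    refine (LinearMap.cancel_right (show Function.Surjective f.toLinearMap from hf)).mp ?_
    have hr : comul.rTensor C' ∘ₗ TensorProduct.map f.toLinearMap f.toLinearMap =
        TensorProduct.map (TensorProduct.map f.toLinearMap f.toLinearMap) f.toLinearMap ∘ₗ
          comul.rTensor C := by
      rw [LinearMap.rTensor_comp_map, LinearMap.map_comp_rTensor, f.map_comp_comul]
    have hl : comul.lTensor C' ∘ₗ TensorProduct.map f.toLinearMap f.toLinearMap =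
        TensorProduct.map f.toLinearMap (TensorProduct.map f.toLinearMap f.toLinearMap) ∘ₗ
          comul.lTensor C := by
      rw [LinearMap.lTensor_comp_map, LinearMap.map_comp_lTensor, f.map_comp_comul]
    rw [LinearMap.comp_assoc, LinearMap.comp_assoc, LinearMap.comp_assoc, ← f.map_comp_comul,
      ← LinearMap.comp_assoc _ _ (comul.rTensor C'), ← LinearMap.comp_assoc _ _ (comul.lTensor C'),
      hr, hl, LinearMap.comp_assoc, LinearMap.comp_assoc, ← coassoc, ← LinearMap.comp_assoc,
      ← TensorProduct.map_map_comp_assoc_eq]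
    rfl
  rTensor_counit_comp_comul := by
    refine (LinearMap.cancel_right (show Function.Surjective f.toLinearMap from hf)).mp ?_
    rw [LinearMap.comp_assoc, ← f.map_comp_comul, ← LinearMap.comp_assoc,
      LinearMap.rTensor_comp_map, f.counit_comp, ← LinearMap.lTensor_comp_rTensor,
      LinearMap.comp_assoc, rTensor_counit_comp_comul]
    rfl
  lTensor_counit_comp_comul := by
    refine (LinearMap.cancel_right (show Function.Surjective f.toLinearMap from hf)).mp ?_
    rw [LinearMap.comp_assoc, ← f.map_comp_comul, ← LinearMap.comp_assoc,
      LinearMap.lTensor_comp_map, f.counit_comp, ← LinearMap.rTensor_comp_lTensor,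
      LinearMap.comp_assoc, lTensor_counit_comp_comul]
    rfl

/-- The bialgebra structure on a surjective image of a bialgebra. -/
abbrev bialgebraOfSurjective [Algebra R H'] [CoalgebraStruct R H'] (f : H →ₐc[R] H')
    (hf : Function.Surjective f) : Bialgebra R H' :=
  have hε (x : H) : counit (R := R) (f x) = counit x := LinearMap.congr_fun f.counit_comp x
  have hΔ (x : H) : comul (f x) =
      Algebra.TensorProduct.map (f : H →ₐ[R] H') (f : H →ₐ[R] H') (comul x) :=
    (LinearMap.congr_fun f.map_comp_comul x).symm
  letI := coalgebraOfSurjective (f : H →ₗc[R] H') hf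
  Bialgebra.mk' R H'
    (by rw [← map_one f, hε, Bialgebra.counit_one])
    (by
      intro a b
      obtain ⟨x, rfl⟩ := hf a
      obtain ⟨y, rfl⟩ := hf b
      rw [← map_mul, hε, hε, hε, Bialgebra.counit_mul])
    (by rw [← map_one f, hΔ, Bialgebra.comul_one, map_one])
    (by
      intro a b
      obtain ⟨x, rfl⟩ := hf a
      obtain ⟨y, rfl⟩ := hf b
      rw [← map_mul, hΔ, hΔ, hΔ, Bialgebra.comul_mul, map_mul])

end Conilpotent

section IsHopf

open WithConv Coalgebra

variable {K : Type v} {H : Type w} {H' : Type u} [Field K] [Ring H] [Ring H']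

theorem IsConilpotent.isHopf [Bialgebra K H] (hH : IsConilpotent K H) : IsHopf K H := by
  obtain ⟨S, hidS, hSid⟩ := isUnit_iff_exists.mp (isUnit_one_sub_of_locally_nilpotent _ hH)
  rw [sub_sub_cancel] at hidS hSid
  exact
    { coassoc := Coalgebra.coassoc
      rTensor_counit := Coalgebra.rTensor_counit_comp_comul
      lTensor_counit := Coalgebra.lTensor_counit_comp_comul
      counit_one := Bialgebra.counit_one
      counit_mul := Bialgebra.counit_mul
      comul_one := Bialgebra.comul_one
      comul_mul := Bialgebra.comul_mul
      antipode := ⟨S.ofConv, congrArg ofConv hSid, congrArg ofConv hidS⟩ }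

theorem IsConilpotent.isHopf_of_surjective [Bialgebra K H] [Algebra K H'] [CoalgebraStruct K H']
    (hH : IsConilpotent K H) (f : H →ₐc[K] H') (hf : Function.Surjective f) : IsHopf K H' :=
  letI := bialgebraOfSurjective f hf
  (hH.of_surjective f hf).isHopf

end IsHopf

/-! ### Algebras generated by cocycles -/

section Cocycle

variable {R H ι : Type*} [CommRing R] [Ring H] [Algebra R H] {g : H} {B : ι → H →ₗ[R] H}

/-- The algebra `H` is generated by `g` under the operators `B i`: the only subalgebra which
contains `g` and is stable under all of them is `H`. -/
def IsGeneratedBy (g : H) (B : ι → H →ₗ[R] H) : Prop :=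
  ∀ T : Subalgebra R H, g ∈ T → (∀ i, ∀ x ∈ T, B i x ∈ T) → T = ⊤

theorem IsGeneratedBy.induction (hgen : IsGeneratedBy g B) {P : H → Prop}
    (algebraMap : ∀ r, P (algebraMap R H r)) (add : ∀ x y, P x → P y → P (x + y))
    (mul : ∀ x y, P x → P y → P (x * y)) (generator : P g) (operator : ∀ i x, P x → P (B i x))
    (x : H) : P x := by
  let T : Subalgebra R H :=
    { carrier := {x | P x}
      algebraMap_mem' := algebraMap
      add_mem' := add _ _
      mul_mem' := mul _ _ }
  have hT : T = ⊤ := hgen T generator operator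
  exact (hT ▸ Algebra.mem_top : x ∈ T)

theorem IsGeneratedBy.algHom_ext (hgen : IsGeneratedBy g B) {A : Type*} [Semiring A] [Algebra R A]
    {f h : H →ₐ[R] A} (generator : f g = h g)
    (operator : ∀ i x, f x = h x → f (B i x) = h (B i x)) : f = h :=
  AlgHom.ext fun x => (hgen (AlgHom.equalizer f h) generator operator ▸ Algebra.mem_top :
    x ∈ AlgHom.equalizer f h)

theorem lTensor_rTensor_comm {M N P Q : Type*} [AddCommGroup M] [Module R M] [AddCommGroup N]
    [Module R N] [AddCommGroup P] [Module R P] [AddCommGroup Q] [Module R Q] (f : M →ₗ[R] N)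
    (g : P →ₗ[R] Q) (z : M ⊗[R] P) : g.lTensor N (f.rTensor P z) = f.rTensor Q (g.lTensor M z) := by
  rw [← LinearMap.comp_apply, LinearMap.lTensor_comp_rTensor, ← LinearMap.rTensor_comp_lTensor,
    LinearMap.comp_apply]

theorem assoc_rTensor_comul_of_cocycle {Δ : H →ₗ[R] H ⊗[R] H} {b : H →ₗ[R] H}
    (hΔb : ∀ x, Δ (b x) = g ⊗ₜ b x + b.rTensor H (Δ x)) (z : H ⊗[R] H) :
    TensorProduct.assoc R H H H (Δ.rTensor H (b.rTensor H z)) =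
      g ⊗ₜ b.rTensor H z +
        b.rTensor (H ⊗[R] H) (TensorProduct.assoc R H H H (Δ.rTensor H z)) := by
  have assoc_rTensor (t : H ⊗[R] H) (y : H) : TensorProduct.assoc R H H H (b.rTensor H t ⊗ₜ y) =
      b.rTensor (H ⊗[R] H) (TensorProduct.assoc R H H H (t ⊗ₜ y)) := by
    induction t using TensorProduct.induction_on with
    | zero => simp
    | tmul a a' => simp
    | add t t' ht ht' => simp only [map_add, TensorProduct.add_tmul, ht, ht']
  induction z using TensorProduct.induction_on with
  | zero => simp
  | tmul x y =>
    simp only [LinearMap.rTensor_tmul, hΔb, TensorProduct.add_tmul, map_add, assoc_rTensor,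
      TensorProduct.assoc_tmul]
  | add z z' hz hz' => simp only [map_add, TensorProduct.tmul_add, hz, hz']; abel

/-- The bialgebra structure on an algebra generated by a group-like element `g` under operators
which are Hochschild 1-cocycles relative to `g`. -/
abbrev bialgebraOfCocycle (hgen : IsGeneratedBy g B) (Δ : H →ₐ[R] H ⊗[R] H) (ε : H →ₐ[R] R)
    (hΔg : Δ g = g ⊗ₜ g) (hεg : ε g = 1)
    (hΔB : ∀ i x, Δ (B i x) = g ⊗ₜ B i x + (B i).rTensor H (Δ x))
    (hεB : ∀ i x, ε (B i x) = 0) : Bialgebra R H :=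
  let δ := Δ.toLinearMap
  Bialgebra.ofAlgHom Δ ε
    (hgen.algHom_ext (by simp [hΔg]) fun i x
        (hx : TensorProduct.assoc R H H H (δ.rTensor H (Δ x)) = δ.lTensor H (Δ x)) =>
      show TensorProduct.assoc R H H H (δ.rTensor H (Δ (B i x))) = δ.lTensor H (Δ (B i x)) by
        rw [hΔB, map_add, map_add, map_add, assoc_rTensor_comul_of_cocycle (hΔB i),
          lTensor_rTensor_comm, hx]
        simp [δ, hΔg, hΔB, TensorProduct.tmul_add, add_assoc])
    (hgen.algHom_ext (by simp [hΔg, hεg]) fun i x _ =>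
      show ε.toLinearMap.rTensor H (Δ (B i x)) = 1 ⊗ₜ B i x by
        have hεB' : ε.toLinearMap ∘ₗ B i = 0 := LinearMap.ext (hεB i)
        rw [hΔB, map_add, ← LinearMap.rTensor_comp_apply, hεB', LinearMap.rTensor_zero]
        simp [hεg])
    (hgen.algHom_ext (by simp [hΔg, hεg]) fun i x
        (hx : ε.toLinearMap.lTensor H (Δ x) = x ⊗ₜ 1) =>
      show ε.toLinearMap.lTensor H (Δ (B i x)) = B i x ⊗ₜ 1 by
        rw [hΔB, map_add, lTensor_rTensor_comm, hx]
        simp [hεB])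

end Cocycle

/-! ### Coopposite bialgebras -/

/-- The coopposite of `H`: the same algebra, whose coproduct is followed by the exchange of the two
tensor factors. -/
def Coopposite (H : Type*) : Type _ := H

namespace Coopposite

variable (R H : Type*) [CommRing R] [Ring H] [Algebra R H]

instance : Ring (Coopposite H) := inferInstanceAs (Ring H)
instance : Algebra R (Coopposite H) := inferInstanceAs (Algebra R H)

instance [CoalgebraStruct R H] : CoalgebraStruct R (Coopposite H) where
  comul := (TensorProduct.comm R H H).toLinearMap ∘ₗ (CoalgebraStruct.comul : H →ₗ[R] H ⊗[R] H)
  counit := (CoalgebraStruct.counit : H →ₗ[R] R)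

end Coopposite

section Antipode

open WithConv Coalgebra HopfAlgebra

variable {K H : Type*} [CommRing K] [Ring H] [HopfAlgebra K H]

/-- Both sides are convolution inverses of the coproduct. -/
theorem comul_antipode (x : H) : comul (R := K) (antipode K x) =
    TensorProduct.map (antipode K) (antipode K)
      (TensorProduct.comm K H H (comul (R := K) x)) := by
  let i₁ : H →ₐ[K] H ⊗[K] H := Algebra.TensorProduct.includeLeft
  let i₂ : H →ₐ[K] H ⊗[K] H := Algebra.TensorProduct.includeRight
  let S : H →ₗ[K] H := antipode K
  let ΔS := TensorProduct.map S S ∘ₗ (TensorProduct.comm K H H).toLinearMap ∘ₗ comul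
  have inverse (i : H →ₐ[K] H ⊗[K] H) :
      toConv (i.toLinearMap ∘ₗ S) * toConv i.toLinearMap = 1 := by
    have h := LinearMap.algHom_comp_convMul_distrib i (toConv S) (toConv LinearMap.id)
    rw [LinearMap.antipode_mul_id, LinearMap.algHom_comp_convOne] at h
    exact (congrArg toConv h).symm
  have comul_eq : (toConv comul : WithConv (H →ₗ[K] H ⊗[K] H)) =
      toConv i₁.toLinearMap * toConv i₂.toLinearMap := by
    ext y
    rw [LinearMap.convMul_apply]
    have h : LinearMap.mul' K (H ⊗[K] H) ∘ₗ TensorProduct.map i₁.toLinearMap i₂.toLinearMap =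
        LinearMap.id := by
      ext; simp [i₁, i₂]
    exact (LinearMap.congr_fun h (comul y)).symm
  have antipode_eq : toConv ΔS = toConv (i₂.toLinearMap ∘ₗ S) * toConv (i₁.toLinearMap ∘ₗ S) := by
    ext y
    rw [LinearMap.convMul_apply]
    have h : LinearMap.mul' K (H ⊗[K] H) ∘ₗ
        TensorProduct.map (i₂.toLinearMap ∘ₗ S) (i₁.toLinearMap ∘ₗ S) =
        TensorProduct.map S S ∘ₗ (TensorProduct.comm K H H).toLinearMap := by
      ext; simp [i₁, i₂]
    exact (LinearMap.congr_fun h (comul y)).symm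
  have left_inverse : toConv ΔS * (toConv comul : WithConv (H →ₗ[K] H ⊗[K] H)) = 1 := by
    rw [antipode_eq, comul_eq, mul_assoc, ← mul_assoc (toConv (i₁.toLinearMap ∘ₗ S)), inverse,
      one_mul, inverse]
  have h := left_inv_eq_right_inv left_inverse (LinearMap.comul_right_inv (R := K) (C := H))
  exact (LinearMap.congr_fun (congrArg ofConv h) x).symm

variable {m : H →ₗc[K] H}

/-- `m ∘ S ∘ m` is an antipode for the opposite product, hence an inverse of `S`. -/
theorem antipode_antimorphism_involutive (hm : Function.Involutive m)
    (hmul : ∀ x y, m (x * y) = m y * m x) : Function.Involutive fun x => antipode K (m x) := by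
  let f : H →ₗ[K] H := antipode K ∘ₗ m.toLinearMap
  have hf (x) : f x = antipode K (m x) := rfl
  have inverse : toConv (antipode K (A := H)) * toConv (f ∘ₗ f) = 1 := by
    ext x
    have h : LinearMap.mul' K H ∘ₗ TensorProduct.map (antipode K) (f ∘ₗ f) =
        f ∘ₗ LinearMap.mul' K H ∘ₗ TensorProduct.map LinearMap.id (antipode K) ∘ₗ
          TensorProduct.map m.toLinearMap m.toLinearMap := by
      ext a b
      simp [hf, hm _, hmul, antipode_mul_antidistrib]
    rw [LinearMap.convMul_apply]
    refine (LinearMap.congr_fun h (comul x)).trans ?_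
    have hx : LinearMap.mul' K H (TensorProduct.map LinearMap.id (antipode K) (comul (m x))) =
        algebraMap K H (counit (m x)) := mul_antipode_lTensor_comul_apply (m x)
    have hone : m 1 = 1 := by simpa [hm _] using (hmul (m 1) 1).symm
    simp [hx, hf, hone, LinearMap.convOne_def, Algebra.algebraMap_eq_smul_one]
  have h := left_inv_eq_right_inv (LinearMap.id_mul_antipode (R := K) (C := H)) inverse
  exact fun x => (LinearMap.congr_fun (congrArg ofConv h) x).symm

theorem exists_algEquiv_comul_eq_comm (hm : Function.Involutive m)
    (hmul : ∀ x y, m (x * y) = m y * m x) :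
    ∃ e : H ≃ₐ[K] H, (∀ x, counit (R := K) (e x) = counit (R := K) x) ∧
      ∀ x, comul (R := K) (e x) = TensorProduct.map e.toLinearMap e.toLinearMap
        (TensorProduct.comm K H H (comul x)) := by
  have hone : m 1 = 1 := by simpa [hm _] using (hmul (m 1) 1).symm
  let f : H →ₐ[K] H := AlgHom.ofLinearMap (antipode K ∘ₗ m.toLinearMap)
    (by simp [hone]) (fun x y => by simp [hmul, antipode_mul_antidistrib])
  have hf := antipode_antimorphism_involutive hm hmul
  refine ⟨AlgEquiv.ofAlgHom f f (AlgHom.ext hf) (AlgHom.ext hf), fun x => ?_, fun x => ?_⟩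
  · exact (counit_antipode (m x)).trans (LinearMap.congr_fun m.counit_comp x)
  · have hmx : TensorProduct.map m.toLinearMap m.toLinearMap (comul x) = comul (m x) :=
      LinearMap.congr_fun m.map_comp_comul x
    change comul (antipode K (m x)) = TensorProduct.map (antipode K ∘ₗ m.toLinearMap)
      (antipode K ∘ₗ m.toLinearMap) (TensorProduct.comm K H H (comul x))
    simp only [comul_antipode, ← hmx, TensorProduct.map_comp, LinearMap.comp_apply,
      TensorProduct.map_comm]

end Antipode

theorem IsHopf.nonempty_coopposite_bialgEquiv {K : Type v} {H : Type w} [Field K] [Ring H]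
    [Algebra K H] [CoalgebraStruct K H] (h : IsHopf K (Coopposite H))
    (m : Coopposite H →ₗc[K] Coopposite H) (hm : Function.Involutive m)
    (hmul : ∀ x y, m (x * y) = m y * m x) : Nonempty (Coopposite H ≃ₐc[K] H) := by
  let _ := h.toHopfAlgebra
  obtain ⟨e, hcounit, hcomul⟩ := exists_algEquiv_comul_eq_comm hm hmul
  let e' : Coopposite H ≃ₐ[K] H := e
  have comul_eq (x : Coopposite H) : TensorProduct.map e'.toLinearMap e'.toLinearMap
      (CoalgebraStruct.comul x) = CoalgebraStruct.comul (R := K) (e' x) := by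
    apply (TensorProduct.comm K H H).injective
    refine Eq.trans ?_ (hcomul x).symm
    exact (TensorProduct.map_comm _ _ _).symm
  exact ⟨{ e' with
    map_smul' := map_smul e'
    counit_comp := LinearMap.ext hcounit
    map_comp_comul := LinearMap.ext comul_eq }⟩

/-! ### Terms and the natural Hopf algebra -/

section Products

theorem map_ofList_flatten {X M : Type*} [Monoid M] (φ : FreeMonoid X →* M) (l : List (List X)) :
    φ (FreeMonoid.ofList l.flatten) = (l.map fun k => φ (FreeMonoid.ofList k)).prod := by
  induction l with
  | nil => simp
  | cons a l ih => rw [List.flatten_cons, FreeMonoid.ofList_append, map_mul, ih]; simp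

theorem map_ofList {X M : Type*} [Monoid M] (φ : FreeMonoid X →* M) (l : List X) :
    φ (FreeMonoid.ofList l) = (l.map fun x => φ (FreeMonoid.of x)).prod := by
  induction l with
  | nil => simp
  | cons x l ih => rw [FreeMonoid.ofList_cons, map_mul, ih]; simp

theorem map_ofList_ofFn {X M : Type*} [Monoid M] (φ : FreeMonoid X →* M) {n : ℕ} (c : Fin n → X) :
    φ (FreeMonoid.ofList (List.ofFn c)) = (List.ofFn fun i => φ (FreeMonoid.of (c i))).prod := by
  rw [map_ofList, List.map_ofFn]
  rfl

theorem prod_ofFn_sum_finset {A : Type*} [Semiring A] {n : ℕ} {ι : Fin n → Type*}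
    (s : ∀ i, Finset (ι i)) (f : ∀ i, ι i → A) :
    (List.ofFn fun i => ∑ j ∈ s i, f i j).prod =
      ∑ p ∈ Fintype.piFinset s, (List.ofFn fun i => f i (p i)).prod := by
  simpa only [MultilinearMap.mkPiAlgebraFin_apply] using
    (MultilinearMap.mkPiAlgebraFin ℕ n A).map_sum_finset f s

theorem prod_ofFn_tmul {R A A' : Type*} [CommSemiring R] [Semiring A] [Algebra R A] [Semiring A']
    [Algebra R A'] {n : ℕ} (a : Fin n → A) (b : Fin n → A') :
    (List.ofFn fun i => a i ⊗ₜ[R] b i).prod = (List.ofFn a).prod ⊗ₜ[R] (List.ofFn b).prod := by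
  induction n with
  | zero => simp [Algebra.TensorProduct.one_def]
  | succ n ih => simp only [List.ofFn_succ, List.prod_cons, ih, Algebra.TensorProduct.tmul_mul_tmul]

end Products

theorem Term.factorizations_injOn_node {S : ℕ → Type u} {n : ℕ} (g : S n) (c : Fin n → Term S) :
    Set.InjOn (fun p : Fin n → Term S × List (Term S) =>
        (Term.node n g fun i => (p i).1, (List.ofFn fun i => (p i).2).flatten))
      (Fintype.piFinset fun i => Term.factorizations (c i)) := by
  intro p hp q hq hpq
  rw [Finset.mem_coe, Fintype.mem_piFinset] at hp hq
  simp only [Prod.mk.injEq, Term.node.injEq, heq_eq_eq, true_and] at hpq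
  have length_eq (i) : (p i).2.length = (q i).2.length := by
    rw [((Term.mem_factorizations _ _ _).mp (hp i)).1,
      ((Term.mem_factorizations _ _ _).mp (hq i)).1,
      congrFun hpq.1 i]
  funext i
  refine Prod.ext (congrFun hpq.1 i) ?_
  rw [← Term.slice_flatten (fun i => (p i).2) i, ← Term.slice_flatten (fun i => (q i).2) i, hpq.2]
  simp only [length_eq]

theorem Term.sum_factorizations_node {S : ℕ → Type u} {M : Type*} [AddCommMonoid M] {n : ℕ}
    (g : S n) (c : Fin n → Term S) (f : Term S × List (Term S) → M) :
    ∑ p ∈ Term.factorizations (Term.node n g c), f p = f (Term.leaf, [Term.node n g c]) +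
      ∑ p ∈ Fintype.piFinset fun i => Term.factorizations (c i),
        f (Term.node n g fun i => (p i).1, (List.ofFn fun i => (p i).2).flatten) := by
  classical
  rw [Term.factorizations, Finset.sum_insert (by simp),
    Finset.sum_image (Term.factorizations_injOn_node g c)]

/-- The algebra of words of terms in which, unlike in `NatHopf`, the leaf is a letter. There, the
factorizations of the terms with root `g` come from those of the words of their children. -/
def TermAlg (K : Type v) (S : ℕ → Type u) [Field K] : Type (max u v) :=
  MonoidAlgebra K (FreeMonoid (Term S))

namespace TermAlg

variable {K : Type v} {S : ℕ → Type u} [Field K]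

instance : Ring (TermAlg K S) := inferInstanceAs (Ring (MonoidAlgebra K (FreeMonoid (Term S))))
instance : Algebra K (TermAlg K S) :=
  inferInstanceAs (Algebra K (MonoidAlgebra K (FreeMonoid (Term S))))

/-- The basis of words of terms. -/
def word : FreeMonoid (Term S) →* TermAlg K S := MonoidAlgebra.of K (FreeMonoid (Term S))

/-- The one-letter words. -/
def letter (t : Term S) : TermAlg K S := word (FreeMonoid.of t)

variable (K S) in
/-- The words as a basis, see `basis_eq_word`. -/
def basis : Module.Basis (FreeMonoid (Term S)) K (TermAlg K S) :=
  MonoidAlgebra.basis (FreeMonoid (Term S)) K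

theorem basis_eq_word (w : FreeMonoid (Term S)) : basis K S w = word w :=
  MonoidAlgebra.basis_apply _ _

/-- The algebra morphism with given values on the letters. -/
def lift {B : Type*} [Ring B] [Algebra K B] (φ : Term S → B) : TermAlg K S →ₐ[K] B :=
  MonoidAlgebra.lift K B (FreeMonoid (Term S)) (FreeMonoid.lift φ)

theorem lift_word {B : Type*} [Ring B] [Algebra K B] (φ : Term S → B) (w : FreeMonoid (Term S)) :
    lift φ (word (K := K) w) = FreeMonoid.lift φ w := MonoidAlgebra.lift_of _ _

theorem lift_letter {B : Type*} [Ring B] [Algebra K B] (φ : Term S → B) (t : Term S) :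
    lift φ (letter (K := K) t) = φ t := by
  rw [letter, lift_word, FreeMonoid.lift_eval_of]

theorem linearMap_ext {M : Type*} [AddCommGroup M] [Module K M] {f h : TermAlg K S →ₗ[K] M}
    (hfh : ∀ w, f (word w) = h (word w)) : f = h :=
  (basis K S).ext fun w => by rw [basis_eq_word, hfh]

theorem algHom_ext {B : Type*} [Ring B] [Algebra K B] {f h : TermAlg K S →ₐ[K] B}
    (hfh : ∀ t, f (letter t) = h (letter t)) : f = h :=
  AlgHom.toLinearMap_injective <| linearMap_ext fun w =>
    DFunLike.congr_fun (FreeMonoid.hom_eq (f := (f : TermAlg K S →* B).comp word)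
      (g := (h : TermAlg K S →* B).comp word) hfh) w

/-- The operator `B⁺` which grafts the words of length `n` on a root `g`, and annihilates the
others. -/
def graft (g : Σ n, S n) : TermAlg K S →ₗ[K] TermAlg K S :=
  (basis K S).constr K fun w =>
    if h : g.1 = w.toList.length then
      letter (Term.node g.1 g.2 fun i => w.toList.get (i.cast h))
    else 0

theorem graft_word (g : Σ n, S n) (w : FreeMonoid (Term S)) :
    graft (K := K) g (word w) = if h : g.1 = w.toList.length then
      letter (Term.node g.1 g.2 fun i => w.toList.get (i.cast h)) else 0 := by
  rw [graft, ← basis_eq_word, Module.Basis.constr_basis]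

theorem graft_ofFn (g : Σ n, S n) (c : Fin g.1 → Term S) :
    graft (K := K) g (word (FreeMonoid.ofList (List.ofFn c))) = letter (Term.node g.1 g.2 c) := by
  rw [graft_word, dif_pos (by simp)]
  congr 2
  funext i
  exact List.get_ofFn _ _

theorem graft_ofFn_of_ne {g : Σ n, S n} {m : ℕ} (h : g.1 ≠ m) (c : Fin m → Term S) :
    graft (K := K) g (word (FreeMonoid.ofList (List.ofFn c))) = 0 := by
  rw [graft_word, dif_neg (by simpa using h)]

theorem graft_ext {M : Type*} [AddCommGroup M] [Module K M] {f h : TermAlg K S →ₗ[K] M}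
    (hfh : ∀ (n : ℕ) (c : Fin n → Term S),
      f (word (FreeMonoid.ofList (List.ofFn c))) = h (word (FreeMonoid.ofList (List.ofFn c)))) :
    f = h :=
  linearMap_ext fun w => by
    rw [← FreeMonoid.ofList_toList w, ← List.ofFn_get w.toList]
    exact hfh _ _

variable (K S) in
theorem isGeneratedBy_leaf :
    IsGeneratedBy (R := K) (letter (K := K) (Term.leaf : Term S)) graft := by
  intro T hleaf hgraft
  have word_mem (l : List (Term S)) (hl : ∀ t ∈ l, letter t ∈ T) :
      word (K := K) (FreeMonoid.ofList l) ∈ T := by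
    rw [map_ofList]
    exact list_prod_mem (List.forall_mem_map.mpr hl)
  have letter_mem (t : Term S) : letter t ∈ T := by
    induction t with
    | leaf => exact hleaf
    | node n g c ih =>
      rw [← graft_ofFn ⟨n, g⟩]
      exact hgraft ⟨n, g⟩ _ (word_mem _ (by simpa using ih))
  refine SetLike.coe_injective (Set.eq_univ_of_forall fun x => ?_)
  induction x using MonoidAlgebra.induction_on with
  | of w => exact word_mem w.toList fun t _ => letter_mem t
  | add x y hx hy => exact add_mem hx hy
  | smul r x hx => exact T.smul_mem hx r

variable (K S) in
/-- The sum over the factorizations, see `factorizations`, without deletion of the leaves. -/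
def comulHom : TermAlg K S →ₐ[K] TermAlg K S ⊗[K] TermAlg K S :=
  lift fun t => ∑ p ∈ t.factorizations, letter p.1 ⊗ₜ[K] word (FreeMonoid.ofList p.2)

variable (K S) in
open Classical in
/-- The counit, which sends the leaf to `1` and the other terms to `0`. -/
def counitHom : TermAlg K S →ₐ[K] K := lift fun t => if t = Term.leaf then 1 else 0

theorem comulHom_leaf :
    comulHom K S (letter Term.leaf) = letter Term.leaf ⊗ₜ[K] letter Term.leaf := by
  rw [comulHom, lift_letter, Term.factorizations, Finset.sum_singleton]
  rfl

theorem comulHom_ofFn {n : ℕ} (c : Fin n → Term S) :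
    comulHom K S (word (FreeMonoid.ofList (List.ofFn c))) =
      ∑ p ∈ Fintype.piFinset fun i => Term.factorizations (c i),
        word (FreeMonoid.ofList (List.ofFn fun i => (p i).1)) ⊗ₜ[K]
          word (FreeMonoid.ofList (List.ofFn fun i => (p i).2).flatten) := by
  rw [comulHom, lift_word, map_ofList_ofFn]
  simp only [FreeMonoid.lift_eval_of]
  rw [prod_ofFn_sum_finset]
  refine Finset.sum_congr rfl fun p _ => ?_
  rw [prod_ofFn_tmul, map_ofList_ofFn, map_ofList_flatten, List.map_ofFn]
  rfl

theorem comulHom_node (g : Σ n, S n) (c : Fin g.1 → Term S) :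
    comulHom K S (letter (Term.node g.1 g.2 c)) =
      letter Term.leaf ⊗ₜ[K] letter (Term.node g.1 g.2 c) +
        (graft g).rTensor _ (comulHom K S (word (FreeMonoid.ofList (List.ofFn c)))) := by
  rw [comulHom_ofFn, comulHom, lift_letter, Term.sum_factorizations_node, map_sum]
  simp only [LinearMap.rTensor_tmul, graft_ofFn]
  rfl

theorem comulHom_graft (g : Σ n, S n) (x : TermAlg K S) : comulHom K S (graft g x) =
    letter Term.leaf ⊗ₜ[K] graft g x + (graft g).rTensor _ (comulHom K S x) := by
  suffices h : (comulHom K S).toLinearMap ∘ₗ graft g =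
      TensorProduct.mk K _ _ (letter Term.leaf) ∘ₗ graft g +
        (graft g).rTensor _ ∘ₗ (comulHom K S).toLinearMap from LinearMap.congr_fun h x
  refine graft_ext fun n c => ?_
  simp only [LinearMap.comp_apply, LinearMap.add_apply, TensorProduct.mk_apply,
    AlgHom.toLinearMap_apply]
  rcases eq_or_ne g.1 n with rfl | h
  · rw [graft_ofFn, comulHom_node]
  · rw [graft_ofFn_of_ne h, map_zero, TensorProduct.tmul_zero, zero_add, comulHom_ofFn, map_sum]
    simp only [LinearMap.rTensor_tmul, graft_ofFn_of_ne h, TensorProduct.zero_tmul,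
      Finset.sum_const_zero]

theorem counitHom_graft (g : Σ n, S n) (x : TermAlg K S) : counitHom K S (graft g x) = 0 := by
  suffices h : (counitHom K S).toLinearMap ∘ₗ graft g = 0 from LinearMap.congr_fun h x
  refine linearMap_ext fun w => ?_
  rw [LinearMap.comp_apply, graft_word]
  split_ifs <;> simp [counitHom, lift_letter]

instance : Bialgebra K (TermAlg K S) :=
  bialgebraOfCocycle (isGeneratedBy_leaf K S) (comulHom K S) (counitHom K S) comulHom_leaf
    (by simp [counitHom, lift_letter]) comulHom_graft counitHom_graft

end TermAlg

section Reduction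

variable {S : ℕ → Type u}

theorem rd_cons (t : Term S) (l : List (Term S)) : rd (t :: l) = rd [t] * rd l := by
  by_cases h : t = Term.leaf <;> simp [rd, h]

theorem rd_leaf : rd [(Term.leaf : Term S)] = 1 := by simp [rd]

theorem rd_of_ne (t : Term S) (h : t ≠ Term.leaf) : rd [t] = FreeMonoid.of ⟨t, h⟩ := by
  simp [rd, h]

theorem RForest.dg_mul (f f' : RForest S) : RForest.dg (f * f') = RForest.dg f + RForest.dg f' := by
  simp [RForest.dg, RForest.terms]

theorem RForest.dg_of (t : ProperTerm S) : RForest.dg (FreeMonoid.of t) = t.1.dg := by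
  simp [RForest.dg, RForest.terms]

theorem RForest.eq_one_of_dg_eq_zero {f : RForest S} (h : RForest.dg f = 0) : f = 1 := by
  induction f using FreeMonoid.inductionOn' with
  | one => rfl
  | of_mul t f _ =>
    obtain ⟨_ | _, ht⟩ := t
    · exact absurd rfl ht
    · simp [RForest.dg, RForest.terms, Term.dg] at h

theorem RForest.dg_rd (l : List (Term S)) : RForest.dg (rd l) = (l.map Term.dg).sum := by
  induction l with
  | nil => rfl
  | cons t l ih =>
    rw [rd_cons, RForest.dg_mul, ih, List.map_cons, List.sum_cons]
    by_cases h : t = Term.leaf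
    · rw [h, rd_leaf]; rfl
    · rw [rd_of_ne t h, RForest.dg_of]

theorem Term.dg_of_mem_factorizations {x : Term S} {p : Term S × List (Term S)}
    (hp : p ∈ Term.factorizations x) : p.1.dg + (p.2.map Term.dg).sum = x.dg := by
  classical
  induction x generalizing p with
  | leaf =>
    rw [Term.factorizations, Finset.mem_singleton] at hp
    simp [hp, Term.dg]
  | node n g c ih =>
    rw [Term.factorizations, Finset.mem_insert, Finset.mem_image] at hp
    rcases hp with rfl | ⟨q, hq, rfl⟩
    · simp [Term.dg]
    · simp only [Term.dg]
      rw [← Finset.sum_congr rfl fun i _ => ih i (Fintype.mem_piFinset.mp hq i),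
        Finset.sum_add_distrib, List.map_flatten, List.sum_flatten, List.map_ofFn, List.map_ofFn,
        List.sum_ofFn, add_assoc]
      rfl

end Reduction

namespace NatHopf

open Coalgebra

variable {K : Type v} {S : ℕ → Type u} [Field K]

theorem E_one : E K S 1 = 1 := MonoidAlgebra.basis_apply _ _

theorem E_mul (f f' : RForest S) : E K S (f * f') = E K S f * E K S f' := by
  let of : RForest S →* NatHopf K S := MonoidAlgebra.of K (RForest S)
  have E_eq (f : RForest S) : E K S f = of f := MonoidAlgebra.basis_apply _ _
  rw [E_eq, E_eq, E_eq, map_mul]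

theorem lift_E_of {B : Type w} [Ring B] [Algebra K B] (φ : ProperTerm S → B) (t : ProperTerm S) :
    lift K S φ (E K S (FreeMonoid.of t)) = φ t := by
  change MonoidAlgebra.lift K B (RForest S) (FreeMonoid.lift φ) (MonoidAlgebra.basis _ _ _) = _
  rw [MonoidAlgebra.basis_apply, MonoidAlgebra.lift_single, one_smul, FreeMonoid.lift_eval_of]

theorem algHom_ext {B : Type w} [Ring B] [Algebra K B] {φ ψ : NatHopf K S →ₐ[K] B}
    (h : ∀ t, φ (E K S (FreeMonoid.of t)) = ψ (E K S (FreeMonoid.of t))) : φ = ψ := by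
  refine AlgHom.toLinearMap_injective ((E K S).ext fun f => ?_)
  induction f using FreeMonoid.inductionOn' with
  | one => simp only [AlgHom.toLinearMap_apply, E_one, map_one]
  | of_mul t f ih =>
    simp only [AlgHom.toLinearMap_apply] at ih ⊢
    rw [E_mul, map_mul, map_mul, h, ih]

/-- The deletion of the leaves. -/
def reductionHom : TermAlg K S →ₐ[K] NatHopf K S := TermAlg.lift fun t => E K S (rd [t])

theorem reductionHom_letter (t : Term S) :
    reductionHom (TermAlg.letter (K := K) t) = E K S (rd [t]) := TermAlg.lift_letter _ _

theorem reductionHom_word (l : List (Term S)) :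
    reductionHom (TermAlg.word (K := K) (FreeMonoid.ofList l)) = E K S (rd l) := by
  induction l with
  | nil => exact (map_one _).trans E_one.symm
  | cons t l ih =>
    rw [FreeMonoid.ofList_cons, map_mul, map_mul, ih, rd_cons, E_mul, ← TermAlg.letter,
      reductionHom_letter]

theorem counit_reductionHom (x : TermAlg K S) :
    CoalgebraStruct.counit (R := K) (reductionHom x) = counit (R := K) x := by
  suffices h : (lift K S fun _ => (0 : K)).comp reductionHom = TermAlg.counitHom K S from
    DFunLike.congr_fun h x
  refine TermAlg.algHom_ext fun t => ?_
  rw [AlgHom.comp_apply, reductionHom_letter, TermAlg.counitHom, TermAlg.lift_letter]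
  split_ifs with ht
  · rw [ht, rd_leaf, E_one, map_one]
  · rw [rd_of_ne t ht, lift_E_of]

theorem comul_reductionHom (x : TermAlg K S) :
    CoalgebraStruct.comul (R := K) (reductionHom x) =
      TensorProduct.map reductionHom.toLinearMap reductionHom.toLinearMap (comul (R := K) x) := by
  suffices h : (lift K S fun x =>
      ∑ p ∈ Term.factorizations x.1, E K S (rd [p.1]) ⊗ₜ[K] E K S (rd p.2)).comp reductionHom =
      (Algebra.TensorProduct.map reductionHom reductionHom).comp (TermAlg.comulHom K S) from
    DFunLike.congr_fun h x
  refine TermAlg.algHom_ext fun t => ?_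
  rw [AlgHom.comp_apply, reductionHom_letter, AlgHom.comp_apply]
  by_cases ht : t = Term.leaf
  · simp only [ht, rd_leaf, E_one, map_one, TermAlg.comulHom_leaf, Algebra.TensorProduct.map_tmul,
      reductionHom_letter, Algebra.TensorProduct.one_def]
  · simp only [rd_of_ne t ht, lift_E_of, TermAlg.comulHom, TermAlg.lift_letter, map_sum,
      Algebra.TensorProduct.map_tmul, reductionHom_letter, reductionHom_word]

variable (K S) in
/-- The deletion of the leaves, as a bialgebra morphism. -/
def reduction : TermAlg K S →ₐc[K] NatHopf K S :=
  { reductionHom with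
    map_smul' := map_smul reductionHom
    counit_comp := LinearMap.ext counit_reductionHom
    map_comp_comul := LinearMap.ext fun x => (comul_reductionHom x).symm }

theorem rd_map_val (f : RForest S) : rd (f.toList.map Subtype.val) = f := by
  induction f using FreeMonoid.inductionOn' with
  | one => rfl
  | of_mul t f ih =>
    rw [FreeMonoid.toList_mul, FreeMonoid.toList_of, List.singleton_append, List.map_cons, rd_cons,
      rd_of_ne t.1 t.2, ih]

variable (K S) in
theorem reduction_surjective : Function.Surjective (reduction K S) := by
  refine (LinearMap.range_eq_top (f := reductionHom.toLinearMap)).mp (top_unique ?_)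
  rw [← (E K S).span_eq, Submodule.span_le]
  rintro _ ⟨f, rfl⟩
  exact ⟨_, (reductionHom_word _).trans (congrArg _ (rd_map_val f))⟩

instance : Bialgebra K (NatHopf K S) :=
  bialgebraOfSurjective (reduction K S) (reduction_surjective K S)

theorem comul_E_of (t : ProperTerm S) : comul (R := K) (E K S (FreeMonoid.of t)) =
    ∑ p ∈ Term.factorizations t.1, E K S (rd [p.1]) ⊗ₜ[K] E K S (rd p.2) := lift_E_of _ _

theorem comul_E_mem_span (f : RForest S) : comul (R := K) (E K S f) ∈
    Submodule.span K {z | ∃ g h, g.dg + h.dg ≤ f.dg ∧ z = E K S g ⊗ₜ[K] E K S h} := by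
  induction f using FreeMonoid.inductionOn' with
  | one =>
    rw [E_one, Bialgebra.comul_one, Algebra.TensorProduct.one_def, ← E_one]
    exact Submodule.subset_span ⟨1, 1, le_rfl, rfl⟩
  | of_mul t f ih =>
    have mem_of : comul (R := K) (E K S (FreeMonoid.of t)) ∈ Submodule.span K {z | ∃ g h,
        g.dg + h.dg ≤ RForest.dg (FreeMonoid.of t) ∧ z = E K S g ⊗ₜ[K] E K S h} := by
      rw [comul_E_of]
      refine Submodule.sum_mem _ fun p hp => Submodule.subset_span ⟨_, _, ?_, rfl⟩
      simp [RForest.dg_rd, RForest.dg_of, ← Term.dg_of_mem_factorizations hp]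
    have mem_mul := Submodule.mul_mem_mul mem_of ih
    rw [E_mul, Bialgebra.comul_mul]
    rw [Submodule.span_mul_span] at mem_mul
    refine Submodule.span_mono ?_ mem_mul
    rintro _ ⟨_, ⟨g, h, hgh, rfl⟩, _, ⟨g', h', hgh', rfl⟩, rfl⟩
    refine ⟨g * g', h * h', ?_, ?_⟩
    · simp only [RForest.dg_mul]
      lia
    · simp only [Algebra.TensorProduct.tmul_mul_tmul, E_mul]

variable (K S) in
theorem isConilpotent : IsConilpotent K (NatHopf K S) :=
  .of_filtration RForest.dg (E K S).span_eq
    (fun f hf => by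
      rw [RForest.eq_one_of_dg_eq_zero hf, E_one, Bialgebra.counit_one, map_one])
    comul_E_mem_span

end NatHopf

/-! ### Planar forests -/

theorem PTree.node_eq_graft {D : Type u} (d : D) {n : ℕ} (c : Fin n → PTree D) :
    PTree.node d n c = PTree.graft d (List.ofFn c) :=
  congrArg (fun p : Σ n, Fin n → PTree D => PTree.node d p.1 p.2)
    (List.equivSigmaTuple.apply_symm_apply (⟨n, c⟩ : Σ n, Fin n → PTree D)).symm

namespace PForest

variable {D : Type u}

@[elab_as_elim]
theorem induction {P : PForest D → Prop} (one : P 1)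
    (graft : ∀ d F, P F → P (FreeMonoid.of (PTree.graft d F.toList)))
    (mul : ∀ F G, P F → P G → P (F * G)) (F : PForest D) : P F := by
  have list (l : List (PTree D)) (hl : ∀ t ∈ l, P (FreeMonoid.of t)) : P (FreeMonoid.ofList l) := by
    induction l with
    | nil => exact one
    | cons t l ih => exact mul _ _ (hl t List.mem_cons_self) (ih fun s hs => hl s (.tail _ hs))
  have tree (t : PTree D) : P (FreeMonoid.of t) := by
    induction t with
    | node d n c ih =>
      rw [PTree.node_eq_graft]
      exact graft d (FreeMonoid.ofList (List.ofFn c)) (list _ (by simpa using ih))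
  exact list F.toList fun t _ => tree t

theorem size_mul (F G : PForest D) : (F * G).size = F.size + G.size := by
  simp [PForest.size]

end PForest

namespace NCK

open Coalgebra

variable {K : Type v} {D : Type u} [Field K]

theorem E_one : E K D 1 = 1 := MonoidAlgebra.basis_apply _ _

theorem E_mul (F G : PForest D) : E K D (F * G) = E K D F * E K D G := by
  let of : PForest D →* NCK K D := MonoidAlgebra.of K (PForest D)
  have E_eq (F : PForest D) : E K D F = of F := MonoidAlgebra.basis_apply _ _
  rw [E_eq, E_eq, E_eq, map_mul]

variable (K D) in
/-- The basis, as a morphism of monoids. -/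
def EHom : PForest D →* NCK K D where
  toFun := E K D
  map_one' := E_one
  map_mul' := E_mul

theorem E_prod_ofFn {n : ℕ} (F : Fin n → PForest D) :
    E K D (List.ofFn F).prod = (List.ofFn fun i => E K D (F i)).prod :=
  (map_list_prod (EHom K D) _).trans (by rw [List.map_ofFn]; rfl)

theorem E_ofList_flatten_ofFn {n : ℕ} (l : Fin n → List (PTree D)) :
    E K D (FreeMonoid.ofList (List.ofFn l).flatten) =
      (List.ofFn fun i => E K D (FreeMonoid.ofList (l i))).prod :=
  (map_ofList_flatten (EHom K D) _).trans (by rw [List.map_ofFn]; rfl)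

theorem lift_E {B : Type w} [Ring B] [Algebra K B] (φ : PTree D → B) (F : PForest D) :
    lift K D φ (E K D F) = FreeMonoid.lift φ F := by
  change MonoidAlgebra.lift K B (PForest D) (FreeMonoid.lift φ) (MonoidAlgebra.basis _ _ _) = _
  rw [MonoidAlgebra.basis_apply, MonoidAlgebra.lift_single, one_smul]

theorem lift_E_of {B : Type w} [Ring B] [Algebra K B] (φ : PTree D → B) (t : PTree D) :
    lift K D φ (E K D (FreeMonoid.of t)) = φ t := by
  rw [lift_E, FreeMonoid.lift_eval_of]

/-- The operator `B⁺` which grafts a forest on a root decorated by `d`. -/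
def graftMap (d : D) : NCK K D →ₗ[K] NCK K D :=
  (E K D).constr K fun F => E K D (FreeMonoid.of (PTree.graft d F.toList))

theorem graftMap_E (d : D) (F : PForest D) :
    graftMap d (E K D F) = E K D (FreeMonoid.of (PTree.graft d F.toList)) :=
  (E K D).constr_basis K _ F

variable (K D) in
theorem isGeneratedBy_one : IsGeneratedBy (1 : NCK K D) (graftMap (K := K)) := by
  intro T _ hgraft
  refine SetLike.coe_injective (Set.eq_univ_of_univ_subset fun x _ => ?_)
  have hT : Submodule.span K (Set.range (E K D)) ≤ T.toSubmodule := by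
    rw [Submodule.span_le]
    rintro _ ⟨F, rfl⟩
    induction F using PForest.induction with
    | one => rw [E_one]; exact T.one_mem
    | graft d F ih => rw [← graftMap_E]; exact hgraft d _ ih
    | mul F G hF hG => rw [E_mul]; exact T.mul_mem hF hG
  exact hT (by rw [(E K D).span_eq]; trivial)

@[elab_as_elim]
theorem induction {P : NCK K D → Prop} (algebraMap : ∀ r, P (algebraMap K _ r))
    (add : ∀ x y, P x → P y → P (x + y)) (mul : ∀ x y, P x → P y → P (x * y))
    (graft : ∀ d x, P x → P (graftMap d x)) (x : NCK K D) : P x :=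
  (isGeneratedBy_one K D).induction algebraMap add mul (by simpa using algebraMap 1) graft x

variable (K D) in
/-- The counit, as an algebra morphism. -/
def counitHom : NCK K D →ₐ[K] K := lift K D fun _ => (0 : K)

theorem counitHom_graftMap (d : D) (x : NCK K D) : counitHom K D (graftMap d x) = 0 := by
  suffices h : (counitHom K D).toLinearMap ∘ₗ graftMap d = 0 from LinearMap.congr_fun h x
  refine (E K D).ext fun F => ?_
  rw [LinearMap.comp_apply, graftMap_E]
  exact lift_E_of _ _

variable (K D) in
/-- The opposite coproduct, as an algebra morphism. -/
def comulOppHom : NCK K D →ₐ[K] NCK K D ⊗[K] NCK K D :=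
  (Algebra.TensorProduct.comm K (NCK K D) (NCK K D)).toAlgHom.comp <|
    lift K D fun t => ∑ c : PTree.Cut t, E K D (FreeMonoid.ofList (PTree.pruned t c)) ⊗ₜ[K]
      E K D (FreeMonoid.ofList (PTree.trunk t c))

theorem comulOppHom_E_of (t : PTree D) : comulOppHom K D (E K D (FreeMonoid.of t)) =
    ∑ c : PTree.Cut t, E K D (FreeMonoid.ofList (PTree.trunk t c)) ⊗ₜ[K]
      E K D (FreeMonoid.ofList (PTree.pruned t c)) := by
  rw [comulOppHom, AlgHom.comp_apply, lift_E_of, map_sum]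
  rfl

theorem comulOppHom_E_ofFn {n : ℕ} (c : Fin n → PTree D) :
    comulOppHom K D (E K D (FreeMonoid.ofList (List.ofFn c))) = ∑ k : ∀ i, PTree.Cut (c i),
      E K D (FreeMonoid.ofList (List.ofFn fun i => PTree.trunk (c i) (k i)).flatten) ⊗ₜ[K]
        E K D (FreeMonoid.ofList (List.ofFn fun i => PTree.pruned (c i) (k i)).flatten) := by
  have h := map_ofList_ofFn
    ((comulOppHom K D : NCK K D →* NCK K D ⊗[K] NCK K D).comp (EHom K D)) c
  refine h.trans ?_
  change (List.ofFn fun i => comulOppHom K D (E K D (FreeMonoid.of (c i)))).prod = _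
  simp only [comulOppHom_E_of, E_ofList_flatten_ofFn, ← prod_ofFn_tmul]
  rw [prod_ofFn_sum_finset, Fintype.piFinset_univ]

theorem comulOppHom_graftMap (d : D) (x : NCK K D) : comulOppHom K D (graftMap d x) =
    1 ⊗ₜ[K] graftMap d x + (graftMap d).rTensor (NCK K D) (comulOppHom K D x) := by
  suffices h : (comulOppHom K D).toLinearMap ∘ₗ graftMap d =
      TensorProduct.mk K (NCK K D) (NCK K D) 1 ∘ₗ graftMap d +
        (graftMap d).rTensor (NCK K D) ∘ₗ (comulOppHom K D).toLinearMap from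
    LinearMap.congr_fun h x
  refine (E K D).ext fun F => ?_
  obtain ⟨n, c, rfl⟩ : ∃ (n : ℕ) (c : Fin n → PTree D), F = FreeMonoid.ofList (List.ofFn c) :=
    ⟨_, F.toList.get, by rw [List.ofFn_get, FreeMonoid.ofList_toList]⟩
  simp only [LinearMap.comp_apply, LinearMap.add_apply, TensorProduct.mk_apply,
    AlgHom.toLinearMap_apply, graftMap_E, FreeMonoid.toList_ofList, ← PTree.node_eq_graft]
  rw [comulOppHom_E_of, comulOppHom_E_ofFn, map_sum]
  simp only [LinearMap.rTensor_tmul, graftMap_E]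
  refine (Fintype.sum_option (α := ∀ i, PTree.Cut (c i)) _).trans ?_
  rw [← E_one]
  rfl

end NCK

/-! ### The leaf-deleting morphism -/

/-- The element of `D` which decorates a generator of the signature `sigD D`. -/
def decoration {D : Type u} {n : ℕ} (g : sigD D n) : D := g

/-- The planar forest, empty or reduced to a tree, obtained from a term by deleting its leaves. -/
def Term.toForest {D : Type u} : Term (sigD D) → PForest D
  | leaf => 1
  | node _ g c =>
    FreeMonoid.of (PTree.graft (decoration g) (List.ofFn fun i => toForest (c i)).prod.toList)

theorem PTree.toForest_toTerm {D : Type u} (t : PTree D) :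
    t.toTerm.toForest = FreeMonoid.of t := by
  induction t with
  | node d n c ih =>
    simp only [PTree.toTerm, Term.toForest, ih]
    rw [PTree.node_eq_graft]
    exact congrArg (fun F : PForest D => FreeMonoid.of (PTree.graft d F.toList))
      (map_ofList_ofFn (MonoidHom.id _) c).symm

namespace NatHopf

open Coalgebra

variable {K : Type v} {D : Type u} [Field K]

variable (K D) in
/-- The algebra morphism deleting the leaves. -/
def toNCKHom : NatHopf K (sigD D) →ₐ[K] NCK K D :=
  lift K (sigD D) fun t => NCK.E K D t.1.toForest

theorem toNCKHom_E_rd (l : List (Term (sigD D))) :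
    toNCKHom K D (E K (sigD D) (rd l)) = NCK.E K D (l.map Term.toForest).prod := by
  induction l with
  | nil => exact (congrArg _ E_one).trans ((map_one _).trans NCK.E_one.symm)
  | cons t l ih =>
    rw [rd_cons, E_mul, map_mul, ih, List.map_cons, List.prod_cons, NCK.E_mul]
    by_cases ht : t = Term.leaf
    · rw [ht, rd_leaf, E_one, map_one, Term.toForest, NCK.E_one]
    · rw [rd_of_ne t ht, toNCKHom, lift_E_of]

theorem toNCKHom_E_toRForest (F : PForest D) :
    toNCKHom K D (E K (sigD D) (PForest.toRForest F)) = NCK.E K D F := by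
  induction F using FreeMonoid.inductionOn' with
  | one => rw [map_one, E_one, map_one, NCK.E_one]
  | of_mul t F ih =>
    rw [map_mul, E_mul, map_mul, ih, NCK.E_mul, PForest.toRForest, FreeMonoid.map_of, toNCKHom,
      lift_E_of, PTree.toForest_toTerm]

theorem comulOppHom_E_toForest (t : Term (sigD D)) :
    NCK.comulOppHom K D (NCK.E K D t.toForest) = ∑ p ∈ Term.factorizations t,
      NCK.E K D p.1.toForest ⊗ₜ[K] NCK.E K D (p.2.map Term.toForest).prod := by
  induction t with
  | leaf =>
    rw [Term.factorizations, Finset.sum_singleton]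
    simp [Term.toForest, NCK.E_one, Algebra.TensorProduct.one_def]
  | node n g c ih =>
    rw [Term.sum_factorizations_node]
    simp only [Term.toForest, ← NCK.graftMap_E, List.map_singleton, List.prod_singleton,
      NCK.E_one, List.map_flatten, List.prod_flatten, List.map_ofFn]
    rw [NCK.comulOppHom_graftMap, NCK.E_prod_ofFn, map_list_prod (NCK.comulOppHom K D),
      List.map_ofFn]
    congr 1
    simp only [Function.comp_def, ih]
    rw [prod_ofFn_sum_finset, map_sum]
    simp only [prod_ofFn_tmul, LinearMap.rTensor_tmul, NCK.E_prod_ofFn]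

theorem comulOppHom_comp_toNCKHom : (NCK.comulOppHom K D).comp (toNCKHom K D) =
    (Algebra.TensorProduct.map (toNCKHom K D) (toNCKHom K D)).comp
      (Bialgebra.comulAlgHom K (NatHopf K (sigD D))) := by
  refine algHom_ext fun t => ?_
  simp only [AlgHom.comp_apply, Bialgebra.comulAlgHom_apply, comul_E_of, map_sum,
    Algebra.TensorProduct.map_tmul, toNCKHom_E_rd, List.map_singleton, List.prod_singleton]
  rw [toNCKHom, lift_E_of, comulOppHom_E_toForest]

theorem counitHom_comp_toNCKHom : (NCK.counitHom K D).comp (toNCKHom K D) =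
    Bialgebra.counitAlgHom K (NatHopf K (sigD D)) := by
  refine algHom_ext fun t => ?_
  rw [AlgHom.comp_apply, Bialgebra.counitAlgHom_apply, toNCKHom, lift_E_of]
  refine Eq.trans ?_ (lift_E_of _ _).symm
  obtain ⟨_ | ⟨n, g, c⟩, ht⟩ := t
  · exact absurd rfl ht
  · exact NCK.lift_E_of _ _

variable (K D) in
/-- The deletion of the leaves, as a bialgebra morphism. -/
def toNCK : NatHopf K (sigD D) →ₐc[K] Coopposite (NCK K D) :=
  let f : NatHopf K (sigD D) →ₐ[K] Coopposite (NCK K D) := toNCKHom K D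
  { f with
    map_smul' := map_smul f
    counit_comp := LinearMap.ext fun x => DFunLike.congr_fun counitHom_comp_toNCKHom x
    map_comp_comul := LinearMap.ext fun x =>
      (DFunLike.congr_fun comulOppHom_comp_toNCKHom x).symm }

variable (K D) in
theorem toNCK_surjective : Function.Surjective (toNCK K D) := by
  refine (LinearMap.range_eq_top (f := (toNCKHom K D).toLinearMap)).mp (top_unique ?_)
  rw [← (NCK.E K D).span_eq, Submodule.span_le]
  rintro _ ⟨F, rfl⟩
  exact ⟨_, toNCKHom_E_toRForest F⟩

end NatHopf

/-! ### Mirror images -/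

theorem map_mul_of_antimorphism {R A : Type*} [CommRing R] [Ring A] [Algebra R A]
    {m : A →ₗ[R] A} (hm : ∀ x y, m (x * y) = m y * m x) (a b : A ⊗[R] A) :
    TensorProduct.map m m (a * b) = TensorProduct.map m m b * TensorProduct.map m m a := by
  have h : (LinearMap.mul R (A ⊗[R] A)).compr₂ (TensorProduct.map m m) =
      (LinearMap.mul R (A ⊗[R] A)).flip.compl₁₂ (TensorProduct.map m m)
        (TensorProduct.map m m) := by
    ext
    simp [hm]
  exact LinearMap.congr_fun₂ h a b

/-- The mirror image of a planar tree. -/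
def PTree.mirror {D : Type u} : PTree D → PTree D
  | node d n c => node d n fun i => mirror (c i.rev)

theorem PTree.mirror_graft {D : Type u} (d : D) (l : List (PTree D)) :
    (PTree.graft d l).mirror = PTree.graft d (l.reverse.map PTree.mirror) := by
  rw [PTree.graft, PTree.mirror, PTree.node_eq_graft]
  congr 1
  refine List.ext_getElem (by simp) fun i _ _ => ?_
  simp [Fin.rev, Nat.add_comm, Nat.sub_sub]

/-- The mirror image of a planar forest. -/
def PForest.mirror {D : Type u} (F : PForest D) : PForest D :=
  FreeMonoid.ofList (F.toList.reverse.map PTree.mirror)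

namespace NCK

variable {K : Type v} {D : Type u} [Field K]

/-- The linear map exchanging a forest and its mirror image. -/
def mirrorMap : NCK K D →ₗ[K] NCK K D := (E K D).constr K fun F => E K D F.mirror

theorem mirrorMap_E (F : PForest D) : mirrorMap (E K D F) = E K D F.mirror :=
  (E K D).constr_basis K _ F

theorem mirrorMap_one : mirrorMap (1 : NCK K D) = 1 := by
  rw [← E_one, mirrorMap_E]
  rfl

theorem mirrorMap_algebraMap (r : K) :
    mirrorMap (algebraMap K (NCK K D) r) = algebraMap K (NCK K D) r := by
  rw [Algebra.algebraMap_eq_smul_one, map_smul, mirrorMap_one]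

theorem mirrorMap_mul (x y : NCK K D) : mirrorMap (x * y) = mirrorMap y * mirrorMap x := by
  have h : (LinearMap.mul K (NCK K D)).compr₂ mirrorMap =
      (LinearMap.mul K (NCK K D)).flip.compl₁₂ mirrorMap mirrorMap :=
    (E K D).ext fun F => (E K D).ext fun G => by
      simp only [LinearMap.compr₂_apply, LinearMap.mul_apply', LinearMap.compl₁₂_apply,
        LinearMap.flip_apply, ← E_mul, mirrorMap_E]
      simp [PForest.mirror]
  exact LinearMap.congr_fun₂ h x y

theorem mirrorMap_graftMap (d : D) (x : NCK K D) :
    mirrorMap (graftMap d x) = graftMap d (mirrorMap x) := by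
  suffices h : mirrorMap ∘ₗ graftMap d = graftMap (K := K) d ∘ₗ mirrorMap from
    LinearMap.congr_fun h x
  refine (E K D).ext fun F => ?_
  simp only [LinearMap.comp_apply, mirrorMap_E, graftMap_E]
  congr 1
  simp [PForest.mirror, PTree.mirror_graft]

theorem mirrorMap_involutive : Function.Involutive (mirrorMap : NCK K D →ₗ[K] NCK K D) := by
  intro x
  induction x using NCK.induction with
  | algebraMap r => rw [mirrorMap_algebraMap, mirrorMap_algebraMap]
  | add x y hx hy => rw [map_add, map_add, hx, hy]
  | mul x y hx hy => rw [mirrorMap_mul, mirrorMap_mul, hx, hy]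
  | graft d x hx => rw [mirrorMap_graftMap, mirrorMap_graftMap, hx]

theorem counitHom_mirrorMap (x : NCK K D) : counitHom K D (mirrorMap x) = counitHom K D x := by
  induction x using NCK.induction with
  | algebraMap r => rw [mirrorMap_algebraMap]
  | add x y hx hy => rw [map_add, map_add, map_add, hx, hy]
  | mul x y hx hy => rw [mirrorMap_mul, map_mul, map_mul, hx, hy, mul_comm]
  | graft d x => rw [mirrorMap_graftMap, counitHom_graftMap, counitHom_graftMap]

theorem comulOppHom_mirrorMap (x : NCK K D) : comulOppHom K D (mirrorMap x) =
    TensorProduct.map mirrorMap mirrorMap (comulOppHom K D x) := by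
  induction x using NCK.induction with
  | algebraMap r =>
    rw [mirrorMap_algebraMap, AlgHom.commutes, Algebra.TensorProduct.algebraMap_apply,
      TensorProduct.map_tmul, mirrorMap_algebraMap, mirrorMap_one]
  | add x y hx hy => simp only [map_add, hx, hy]
  | mul x y hx hy =>
    rw [mirrorMap_mul, map_mul, map_mul, hx, hy, map_mul_of_antimorphism mirrorMap_mul]
  | graft d x hx =>
    have comm : (graftMap d).rTensor (NCK K D) ∘ₗ TensorProduct.map mirrorMap mirrorMap =
        TensorProduct.map mirrorMap mirrorMap ∘ₗ (graftMap d).rTensor (NCK K D) := by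
      refine TensorProduct.ext' fun a b => ?_
      simp [mirrorMap_graftMap]
    rw [mirrorMap_graftMap, comulOppHom_graftMap, comulOppHom_graftMap, hx, map_add,
      TensorProduct.map_tmul, mirrorMap_one, mirrorMap_graftMap]
    exact congrArg _ (LinearMap.congr_fun comm _)

variable (K D) in
theorem nonempty_coopposite_bialgEquiv : Nonempty (Coopposite (NCK K D) ≃ₐc[K] NCK K D) :=
  ((NatHopf.isConilpotent K (sigD D)).isHopf_of_surjective _
    (NatHopf.toNCK_surjective K D)).nonempty_coopposite_bialgEquiv
      { (mirrorMap : NCK K D →ₗ[K] NCK K D) with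
        counit_comp := LinearMap.ext counitHom_mirrorMap
        map_comp_comul := LinearMap.ext fun x => (comulOppHom_mirrorMap x).symm }
      mirrorMap_involutive mirrorMap_mul

variable (K D) in
theorem isHopf : IsHopf K (NCK K D) := by
  obtain ⟨e⟩ := nonempty_coopposite_bialgEquiv K D
  exact (NatHopf.isConilpotent K (sigD D)).isHopf_of_surjective
    ((e : Coopposite (NCK K D) →ₐc[K] NCK K D).comp (NatHopf.toNCK K D))
    (e.surjective.comp (NatHopf.toNCK_surjective K D))

end NCK

/-! ### Compatible words -/

theorem sum_Iio_zero {n : ℕ} (m : Fin (n + 1) → ℕ) : ∑ k ∈ Finset.Iio 0, m k = 0 := by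
  rw [show Finset.Iio (0 : Fin (n + 1)) = ∅ from Finset.Iio_bot, Finset.sum_empty]

theorem sum_Iio_succ {n : ℕ} (m : Fin (n + 1) → ℕ) (i : Fin n) :
    ∑ k ∈ Finset.Iio i.succ, m k = m 0 + ∑ k ∈ Finset.Iio i, m k.succ := by
  simp only [← Finset.filter_gt_eq_Iio, Finset.sum_filter, Fin.sum_univ_succ, Fin.succ_pos,
    if_true, Fin.succ_lt_succ_iff]

namespace Term

variable {S : ℕ → Type u}

theorem childPos_zero {n : ℕ} (c : Fin (n + 1) → Term S) : childPos c 0 = 1 := by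
  rw [childPos, sum_Iio_zero]

theorem childPos_succ {n : ℕ} (c : Fin (n + 1) → Term S) (i : Fin n) :
    childPos c i.succ = (c 0).dg + childPos (fun k => c k.succ) i := by
  rw [childPos, childPos, sum_Iio_succ, Nat.add_left_comm]

theorem childPos_pos {n : ℕ} (c : Fin n → Term S) (i : Fin n) : 0 < childPos c i :=
  Nat.add_pos_left one_pos _

theorem childPos_add_dg_le {n : ℕ} (g : S n) (c : Fin n → Term S) (i : Fin n) :
    childPos c i + (c i).dg ≤ (node n g c).dg := by
  have h : ∑ k ∈ insert i (Finset.Iio i), (c k).dg ≤ ∑ k, (c k).dg :=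
    Finset.sum_le_sum_of_subset (Finset.subset_univ _)
  rw [Finset.sum_insert (by simp)] at h
  rw [childPos, dg]
  lia

theorem dg_pos {t : Term S} (ht : t ≠ leaf) : 0 < t.dg := by
  cases t with
  | leaf => exact absurd rfl ht
  | node n g c => exact Nat.add_pos_left one_pos _

theorem Edge.lt_dg {t : Term S} {j a b : ℕ} (h : t.Edge j a b) : a < t.dg ∧ b < t.dg := by
  induction t generalizing j a b with
  | leaf => exact h.elim
  | node n g c ih =>
    rcases h with ⟨i, -, hi, rfl, rfl⟩ | ⟨i, a', b', h, rfl, rfl⟩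
    · have := childPos_add_dg_le g c i
      have := dg_pos hi
      lia
    · have := childPos_add_dg_le g c i
      have := ih i h
      lia

theorem length_decs (t : Term S) : t.decs.length = t.dg := by
  induction t with
  | leaf => rfl
  | node n g c ih =>
    simp only [decs, dg, List.length_cons, List.length_flatten, List.map_ofFn, List.sum_ofFn,
      Function.comp_apply, ih, Nat.add_comm]

end Term

namespace RForest

variable {S : ℕ → Type u} (t : ProperTerm S) (f : RForest S)

theorem terms_of_mul : terms (FreeMonoid.of t * f) = t.1 :: f.terms := rfl

theorem isRoot_of_mul (i : ℕ) : IsRoot (FreeMonoid.of t * f) i ↔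
    i = 0 ∨ ∃ i', f.IsRoot i' ∧ i = t.1.dg + i' := by
  simp only [IsRoot, pos, terms_of_mul, List.length_cons, Nat.exists_lt_succ_left, List.take_zero,
    List.take_succ_cons, List.map_cons, List.sum_cons]
  simp

theorem edge_of_mul (j a b : ℕ) : Edge (FreeMonoid.of t * f) j a b ↔
    t.1.Edge j a b ∨ ∃ a' b', f.Edge j a' b' ∧ a = t.1.dg + a' ∧ b = t.1.dg + b' := by
  simp only [Edge, pos, terms_of_mul]
  constructor
  · rintro ⟨k | k, s, a', b', hk, h, rfl, rfl⟩
    · obtain rfl : t.1 = s := by simpa using hk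
      exact .inl (by simpa using h)
    · exact .inr ⟨_, _, ⟨k, s, a', b', by simpa using hk, h, rfl, rfl⟩, by simp [Nat.add_assoc],
        by simp [Nat.add_assoc]⟩
  · rintro (h | ⟨_, _, ⟨k, s, a', b', hk, h, rfl, rfl⟩, rfl, rfl⟩)
    · exact ⟨0, t.1, a, b, rfl, h, by simp, by simp⟩
    · exact ⟨k + 1, s, a', b', by simpa using hk, h, by simp [Nat.add_assoc],
        by simp [Nat.add_assoc]⟩

theorem decs_of_mul : decs (FreeMonoid.of t * f) = t.1.decs ++ f.decs := rfl

theorem isRoot_rd_cons (t : Term S) (l : List (Term S)) (i : ℕ) : (rd (t :: l)).IsRoot i ↔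
    (t ≠ Term.leaf ∧ i = 0) ∨ ∃ i', (rd l).IsRoot i' ∧ i = t.dg + i' := by
  by_cases ht : t = Term.leaf
  · rw [rd_cons, ht, rd_leaf, one_mul]
    simp [Term.dg]
  · rw [rd_cons, rd_of_ne t ht, isRoot_of_mul]
    simp [ht]

theorem edge_rd_cons (t : Term S) (l : List (Term S)) (j a b : ℕ) : (rd (t :: l)).Edge j a b ↔
    t.Edge j a b ∨ ∃ a' b', (rd l).Edge j a' b' ∧ a = t.dg + a' ∧ b = t.dg + b' := by
  by_cases ht : t = Term.leaf
  · rw [rd_cons, ht, rd_leaf, one_mul]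
    simp [Term.dg, Term.Edge]
  · rw [rd_cons, rd_of_ne t ht, edge_of_mul]

theorem decs_rd (l : List (Term S)) : (rd l).decs = (l.map Term.decs).flatten := by
  induction l with
  | nil => rfl
  | cons t l ih =>
    by_cases ht : t = Term.leaf
    · rw [rd_cons, ht, rd_leaf, one_mul, ih]
      rfl
    · rw [rd_cons, rd_of_ne t ht, decs_of_mul, ih]
      rfl

theorem isRoot_rd_ofFn {n : ℕ} (c : Fin n → Term S) (i : ℕ) :
    (rd (List.ofFn c)).IsRoot i ↔ ∃ k, c k ≠ Term.leaf ∧ i + 1 = Term.childPos c k := by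
  induction n generalizing i with
  | zero => simp [IsRoot, rd, terms]
  | succ n ih =>
    simp only [List.ofFn_succ, isRoot_rd_cons, ih, Fin.exists_fin_succ, Term.childPos_zero,
      Term.childPos_succ]
    constructor
    · rintro (⟨h, rfl⟩ | ⟨i', ⟨k, h, hi⟩, rfl⟩)
      exacts [.inl ⟨h, rfl⟩, .inr ⟨k, h, by lia⟩]
    · rintro (⟨h, hi⟩ | ⟨k, h, hi⟩)
      · exact .inl ⟨h, by lia⟩
      · have := Term.childPos_pos (fun k => c k.succ) k
        exact .inr ⟨i - (c 0).dg, ⟨k, h, by lia⟩, by lia⟩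

theorem edge_rd_ofFn {n : ℕ} (c : Fin n → Term S) (j a b : ℕ) :
    (rd (List.ofFn c)).Edge j a b ↔ ∃ k a' b', (c k).Edge j a' b' ∧
      a + 1 = Term.childPos c k + a' ∧ b + 1 = Term.childPos c k + b' := by
  induction n generalizing a b with
  | zero => simp [Edge, rd, terms]
  | succ n ih =>
    simp only [List.ofFn_succ, edge_rd_cons, ih, Fin.exists_fin_succ, Term.childPos_zero,
      Term.childPos_succ]
    constructor
    · rintro (h | ⟨a', b', ⟨k, i, i', h, ha, hb⟩, rfl, rfl⟩)
      exacts [.inl ⟨a, b, h, by lia, by lia⟩, .inr ⟨k, i, i', h, by lia, by lia⟩]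
    · rintro (⟨a', b', h, ha, hb⟩ | ⟨k, i, i', h, ha, hb⟩)
      · obtain ⟨rfl, rfl⟩ : a = a' ∧ b = b' := by lia
        exact .inl h
      · have := Term.childPos_pos (fun k => c k.succ) k
        exact .inr ⟨a - (c 0).dg, b - (c 0).dg, ⟨k, i, i', h, by lia, by lia⟩, by lia, by lia⟩

end RForest

theorem Term.edge_node {S : ℕ → Type u} {n : ℕ} (g : S n) (c : Fin n → Term S) (j a b : ℕ) :
    (node n g c).Edge j a b ↔ (∃ k : Fin n, k.val = j ∧ c k ≠ leaf ∧ a = 0 ∧ b = childPos c k) ∨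
      ∃ a' b', (rd (List.ofFn c)).Edge j a' b' ∧ a = a' + 1 ∧ b = b' + 1 := by
  simp only [RForest.edge_rd_ofFn, Edge]
  refine or_congr_right ⟨?_, ?_⟩
  · rintro ⟨k, a', b', h, rfl, rfl⟩
    have := childPos_pos c k
    exact ⟨childPos c k + a' - 1, childPos c k + b' - 1, ⟨k, a', b', h, by lia, by lia⟩,
      by lia, by lia⟩
  · rintro ⟨_, _, ⟨k, a', b', h, ha, hb⟩, rfl, rfl⟩
    exact ⟨k, a', b', h, ha, hb⟩

theorem Term.decs_node {S : ℕ → Type u} {n : ℕ} (g : S n) (c : Fin n → Term S) :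
    (node n g c).decs = ⟨n, g⟩ :: (rd (List.ofFn c)).decs := by
  rw [RForest.decs_rd, List.map_ofFn]
  rfl

theorem Term.dg_node {S : ℕ → Type u} {n : ℕ} (g : S n) (c : Fin n → Term S) :
    (node n g c).dg = (rd (List.ofFn c)).dg + 1 := by
  rw [RForest.dg_rd, List.map_ofFn, List.sum_ofFn, dg, Nat.add_comm]
  rfl

namespace RForest

variable {S : ℕ → Type u} (t : ProperTerm S)

theorem isRoot_of (i : ℕ) : IsRoot (FreeMonoid.of t) i ↔ i = 0 := by
  simpa [IsRoot, terms] using isRoot_of_mul t 1 i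

theorem edge_of (j a b : ℕ) : Edge (FreeMonoid.of t) j a b ↔ t.1.Edge j a b := by
  simpa [Edge, terms] using edge_of_mul t 1 j a b

theorem decs_of : decs (FreeMonoid.of t) = t.1.decs := List.append_nil _

end RForest

namespace ForestLike

variable {S : ℕ → Type u} {A : Type u} (B : ForestLike S A)

theorem compatible_one_iff (w : List A) : B.Compatible 1 w ↔ w = [] := by
  refine ⟨fun h => List.length_eq_zero_iff.mp h.length_eq, ?_⟩
  rintro rfl
  exact ⟨rfl, by simp, by simp, by simp⟩

theorem compatible_of_mul_iff (t : ProperTerm S) (f : RForest S) {u v : List A}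
    (hu : u.length = t.1.dg) : B.Compatible (FreeMonoid.of t * f) (u ++ v) ↔
      B.Compatible (FreeMonoid.of t) u ∧ B.Compatible f v := by
  have hpos := Term.dg_pos t.2
  have hdecs := t.1.length_decs
  have left {i : ℕ} {x : A} (h : u[i]? = some x) : (u ++ v)[i]? = some x := by grind
  have right {i : ℕ} {x : A} (h : v[i]? = some x) : (u ++ v)[t.1.dg + i]? = some x := by grind
  have decs_right (i : ℕ) : (t.1.decs ++ f.decs)[t.1.dg + i]? = f.decs[i]? := by grind
  constructor
  · rintro ⟨hlen, hroot, hdec, hedge⟩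
    simp only [RForest.isRoot_of_mul, RForest.decs_of_mul, RForest.edge_of_mul, RForest.dg_mul,
      RForest.dg_of, List.length_append] at hlen hroot hdec hedge
    constructor
    · constructor <;> simp only [RForest.isRoot_of, RForest.decs_of, RForest.edge_of, RForest.dg_of]
      · exact hu
      · exact fun i x hx hi => hroot i x (left hx) (.inl hi)
      · exact fun i x n g hx hi => hdec i x n g (left hx) (by grind)
      · exact fun j i i' x x' hx hx' h => hedge j i i' x x' (left hx) (left hx') (.inl h)
    · constructor
      · lia
      · exact fun i x hx hi => hroot _ x (right hx) (.inr ⟨i, hi, rfl⟩)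
      · exact fun i x n g hx hi => hdec _ x n g (right hx) (decs_right i ▸ hi)
      · exact fun j i i' x x' hx hx' h =>
          hedge j _ _ x x' (right hx) (right hx') (.inr ⟨i, i', h, rfl, rfl⟩)
  · rintro ⟨⟨-, hroot, hdec, hedge⟩, hlen', hroot', hdec', hedge'⟩
    simp only [RForest.isRoot_of, RForest.decs_of, RForest.edge_of] at hroot hdec hedge
    constructor <;> simp only [RForest.isRoot_of_mul, RForest.decs_of_mul, RForest.edge_of_mul,
      RForest.dg_mul, RForest.dg_of, List.length_append]
    · lia
    · rintro _ x hx (rfl | ⟨i, hi, rfl⟩)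
      · exact hroot 0 x (by grind) rfl
      · exact hroot' i x (by grind) hi
    · intro i x n g hx hi
      by_cases hlt : i < t.1.dg
      · exact hdec i x n g (by grind) (by grind)
      · exact hdec' (i - t.1.dg) x n g (by grind) (by grind)
    · rintro j i i' x x' hx hx' (h | ⟨i, i', h, rfl, rfl⟩)
      · have := h.lt_dg
        exact hedge j i i' x x' (by grind) (by grind) h
      · exact hedge' j i i' x x' (by grind) (by grind) h

/-- The alphabet `B` with `R` as root relation. Reading a word from left to right, it keeps track of
the letters at which the subtrees of a node that has just been read may start. -/
def withRoot (R : A → Prop) : ForestLike S A := { B with root := R }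

variable {B} in
theorem compatible_of_node_iff (hB : ∀ j, B.edge j = B.edge 0) {n : ℕ} (g : S n)
    (c : Fin n → Term S) (h : Term.node n g c ≠ Term.leaf) (a : A) (w : List A) :
    B.Compatible (FreeMonoid.of ⟨Term.node n g c, h⟩) (a :: w) ↔
      B.root a ∧ B.dec n g a ∧ (B.withRoot (B.edge 0 a)).Compatible (rd (List.ofFn c)) w := by
  constructor
  · rintro ⟨hlen, hroot, hdec, hedge⟩
    simp only [RForest.isRoot_of, RForest.decs_of, RForest.edge_of, RForest.dg_of,
      Term.dg_node, Term.edge_node, Term.decs_node] at hlen hroot hdec hedge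
    refine ⟨hroot 0 a rfl rfl, hdec 0 a n g rfl rfl, ?_⟩
    constructor
    · simpa using hlen
    · intro i x hx hi
      obtain ⟨k, hk, hik⟩ := (RForest.isRoot_rd_ofFn c i).mp hi
      rw [withRoot, ← hB k]
      exact hedge k 0 (i + 1) a x rfl hx (.inl ⟨k, rfl, hk, rfl, hik⟩)
    · exact fun i x m g' hx hi => hdec (i + 1) x m g' hx hi
    · exact fun j i i' x x' hx hx' h =>
        hedge j (i + 1) (i' + 1) x x' hx hx' (.inr ⟨i, i', h, rfl, rfl⟩)
  · rintro ⟨hroot, hdec, hlen, hroot', hdec', hedge⟩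
    constructor <;> simp only [RForest.isRoot_of, RForest.decs_of, RForest.edge_of, RForest.dg_of,
      Term.dg_node, Term.edge_node, Term.decs_node]
    · simpa using hlen
    · rintro i x hx rfl
      obtain rfl : a = x := by simpa using hx
      exact hroot
    · rintro (_ | i) x m g' hx hi
      · obtain rfl : a = x := by simpa using hx
        cases hi
        exact hdec
      · exact hdec' i x m g' hx hi
    · rintro j _ _ x x' hx hx' (⟨k, rfl, hk, rfl, rfl⟩ | ⟨i, i', h, rfl, rfl⟩)
      · obtain rfl : a = x := by simpa using hx
        obtain ⟨i, hi⟩ : ∃ i, Term.childPos c k = i + 1 :=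
          Nat.exists_eq_add_one.mpr (Term.childPos_pos c k)
        rw [hi] at hx'
        rw [hB]
        exact hroot' i x' hx' ((RForest.isRoot_rd_ofFn c i).mpr ⟨k, hk, hi.symm⟩)
      · exact hedge j i i' x x' hx hx' h

end ForestLike

/-! ### The realization as an algebra morphism -/

namespace NCPoly

variable {K : Type v} [Field K] {A : Type u}

theorem ext {p q : NCPoly K A} (h : ∀ w, coeff p w = coeff q w) : p = q :=
  Subtype.ext (funext h)

open Classical in
theorem coeff_one (w : List A) : coeff (1 : NCPoly K A) w = if w = [] then 1 else 0 := by
  cases w <;> rfl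

theorem coeff_mul (p q : NCPoly K A) (w : List A) : coeff (p * q) w =
    ∑ i ∈ Finset.range (w.length + 1), coeff p (w.take i) * coeff q (w.drop i) := rfl

/-- The linear map sending a polynomial to the polynomial of the coefficients of the words starting
with `a`. -/
def quot (a : A) : NCPoly K A →ₗ[K] NCPoly K A where
  toFun p := ⟨NCSeries.quot p.1 a, p.2.imp fun _ hn w hw => hn (a :: w) (Nat.lt_succ_of_lt hw)⟩
  map_add' _ _ := rfl
  map_smul' _ _ := rfl

theorem coeff_quot (a : A) (p : NCPoly K A) (w : List A) :
    coeff (quot a p) w = coeff p (a :: w) := rfl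

theorem ext_quot {p q : NCPoly K A} (nil : coeff p [] = coeff q [])
    (cons : ∀ a, quot a p = quot a q) : p = q :=
  ext fun
    | [] => nil
    | a :: w => congrArg (coeff · w) (cons a)

/-- The coefficient of a word, as a linear form. -/
def coeffₗ (w : List A) : NCPoly K A →ₗ[K] K where
  toFun p := coeff p w
  map_add' _ _ := rfl
  map_smul' _ _ := rfl

end NCPoly

namespace ForestLike

variable {K : Type v} [Field K] {S : ℕ → Type u} {A : Type u} (B : ForestLike S A)

open Classical in
theorem coeff_forestPoly (f : RForest S) (w : List A) :
    NCPoly.coeff (B.forestPoly K f) w = if B.Compatible f w then 1 else 0 := rfl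

theorem coeff_nil_forestPoly_of (t : ProperTerm S) :
    NCPoly.coeff (B.forestPoly K (FreeMonoid.of t)) [] = 0 := by
  rw [coeff_forestPoly, if_neg]
  intro h
  have h_length := h.length_eq
  rw [RForest.dg_of] at h_length
  exact (Term.dg_pos t.2).ne h_length

theorem forestPoly_one : B.forestPoly K 1 = 1 := by
  refine NCPoly.ext fun w => ?_
  rw [coeff_forestPoly]
  simp only [compatible_one_iff]
  cases w <;> rfl

theorem forestPoly_of_mul (t : ProperTerm S) (f : RForest S) :
    B.forestPoly K (FreeMonoid.of t * f) =
      B.forestPoly K (FreeMonoid.of t) * B.forestPoly K f := by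
  classical
  refine NCPoly.ext fun w => ?_
  rw [NCPoly.coeff_mul]
  simp only [coeff_forestPoly]
  by_cases hw : t.1.dg ≤ w.length
  · have hlen : (w.take t.1.dg).length = t.1.dg := List.length_take_of_le hw
    rw [Finset.sum_eq_single_of_mem t.1.dg (by simpa using Nat.lt_succ_of_le hw)]
    · conv_lhs => rw [← List.take_append_drop t.1.dg w]
      rw [ite_zero_mul_ite_zero, mul_one]
      exact if_congr (B.compatible_of_mul_iff t f hlen) rfl rfl
    · intro i hi hne
      rw [if_neg, zero_mul]
      intro h
      have h_length := h.length_eq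
      rw [RForest.dg_of, List.length_take_of_le (by simpa [Nat.lt_succ_iff] using hi)] at h_length
      exact hne h_length
  · rw [if_neg, Finset.sum_eq_zero]
    · intro i _
      rw [if_neg, zero_mul]
      intro h
      have h_length := h.length_eq
      rw [RForest.dg_of, List.length_take] at h_length
      lia
    · intro h
      have h_length := h.length_eq
      rw [RForest.dg_mul, RForest.dg_of] at h_length
      lia

theorem forestPoly_mul (f f' : RForest S) :
    B.forestPoly K (f * f') = B.forestPoly K f * B.forestPoly K f' := by
  induction f using FreeMonoid.inductionOn' with
  | one => rw [one_mul, forestPoly_one, one_mul]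
  | of_mul t f ih => rw [mul_assoc, forestPoly_of_mul, ih, forestPoly_of_mul, mul_assoc]

variable (K) in
/-- The realization map as an algebra morphism. -/
def realizeHom : NatHopf K S →ₐ[K] NCPoly K A :=
  NatHopf.lift K S fun t => B.forestPoly K (FreeMonoid.of t)

theorem realizeHom_E (f : RForest S) : B.realizeHom K (NatHopf.E K S f) = B.forestPoly K f := by
  induction f using FreeMonoid.inductionOn' with
  | one => rw [NatHopf.E_one, map_one, forestPoly_one]
  | of_mul t f ih =>
    rw [NatHopf.E_mul, map_mul, ih, forestPoly_of_mul, realizeHom, NatHopf.lift_E_of]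

theorem realizeHom_toLinearMap : (B.realizeHom K).toLinearMap = B.realize K :=
  (NatHopf.E K S).ext fun f => by
    rw [AlgHom.toLinearMap_apply, realizeHom_E, realize, Module.Basis.constr_basis]

theorem forestPoly_rd (l : List (Term S)) :
    B.forestPoly K (rd l) = (l.map fun t => B.forestPoly K (rd [t])).prod := by
  induction l with
  | nil => exact B.forestPoly_one
  | cons t l ih => rw [rd_cons, forestPoly_mul, ih, List.map_cons, List.prod_cons]

end ForestLike

section Uniform

variable {K : Type v} [Field K] {D : Type u} {A : Type u} {B : ForestLike (sigD D) A}

theorem PForest.rd_map_toTerm (l : List (PTree D)) :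
    rd (l.map PTree.toTerm) = PForest.toRForest (FreeMonoid.ofList l) := by
  induction l with
  | nil => rfl
  | cons t l ih =>
    rw [List.map_cons, rd_cons, rd_of_ne _ t.toTerm_ne_leaf, ih, FreeMonoid.ofList_cons, map_mul]
    rfl

theorem IsUniform.withRoot (hB : IsUniform B) (R : A → Prop) : IsUniform (B.withRoot R) := hB

variable (K B) in
/-- The realization map of decorated planar forests, as an algebra morphism. -/
def realizeNCKHom : NCK K D →ₐ[K] NCPoly K A :=
  NCK.lift K D fun t => B.forestPoly K (PForest.toRForest (FreeMonoid.of t))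

theorem realizeNCKHom_E (F : PForest D) :
    realizeNCKHom K B (NCK.E K D F) = B.forestPoly K (PForest.toRForest F) := by
  induction F using FreeMonoid.inductionOn' with
  | one => rw [NCK.E_one, map_one, map_one, B.forestPoly_one]
  | of_mul t F ih =>
    rw [NCK.E_mul, map_mul, ih, map_mul, B.forestPoly_mul, realizeNCKHom, NCK.lift_E_of]

theorem realizeNCKHom_toLinearMap : (realizeNCKHom K B).toLinearMap = realizeNCK K B :=
  (NCK.E K D).ext fun F => by
    rw [AlgHom.toLinearMap_apply, realizeNCKHom_E, realizeNCK, Module.Basis.constr_basis,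
      ForestLike.realize, Module.Basis.constr_basis]

open Classical in
theorem quot_forestPoly_node (hB : IsUniform B) (n : ℕ) (d : sigD D n) (c : Fin n → Term (sigD D))
    (h : Term.node n d c ≠ Term.leaf) (a : A) :
    NCPoly.quot a (B.forestPoly K (FreeMonoid.of ⟨Term.node n d c, h⟩)) =
      if B.root a ∧ B.dec 0 (decoration (D := D) d) a then
        (B.withRoot (B.edge 0 a)).forestPoly K (rd (List.ofFn c)) else 0 := by
  have h_dec : B.dec n d a ↔ B.dec 0 (decoration (D := D) d) a :=
    iff_of_eq (congrFun (hB.1 _ n 0) a)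
  refine NCPoly.ext fun w => ?_
  rw [NCPoly.coeff_quot, B.coeff_forestPoly,
    ForestLike.compatible_of_node_iff (fun j => hB.2 j 0), h_dec, ← and_assoc]
  split_ifs with h₁ h₂ h₂
  · exact (if_pos h₁.2).symm
  · exact absurd h₁.1 h₂
  · exact (if_neg fun h₃ => h₁ ⟨h₂, h₃⟩).symm
  · rfl

open Classical in
theorem quot_realizeNCKHom_graftMap (hB : IsUniform B) (d : D) (x : NCK K D) (a : A) :
    NCPoly.quot a (realizeNCKHom K B (NCK.graftMap d x)) =
      if B.root a ∧ B.dec 0 d a then realizeNCKHom K (B.withRoot (B.edge 0 a)) x else 0 := by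
  suffices h : NCPoly.quot a ∘ₗ (realizeNCKHom K B).toLinearMap ∘ₗ NCK.graftMap d =
      if B.root a ∧ B.dec 0 d a then
        (realizeNCKHom K (B.withRoot (B.edge 0 a))).toLinearMap else 0 by
    have := LinearMap.congr_fun h x
    split_ifs at this ⊢ <;> exact this
  refine (NCK.E K D).ext fun F => ?_
  have h_node := quot_forestPoly_node (K := K) hB F.toList.length d
    (fun i => (F.toList.get i).toTerm) (PTree.toTerm_ne_leaf (PTree.graft d F.toList)) a
  have h_ofFn (l : List (PTree D)) :
      List.ofFn (fun i => (l.get i).toTerm) = l.map PTree.toTerm := by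
    rw [← Function.comp_def, ← List.map_ofFn, List.ofFn_get]
  rw [h_ofFn, PForest.rd_map_toTerm, FreeMonoid.ofList_toList, ← realizeNCKHom_E] at h_node
  simp only [LinearMap.comp_apply, AlgHom.toLinearMap_apply, NCK.graftMap_E]
  rw [realizeNCKHom_E]
  refine h_node.trans ?_
  split_ifs <;> first | rfl | contradiction

theorem coeff_nil_realizeNCKHom_graftMap (d : D) (x : NCK K D) :
    NCPoly.coeff (realizeNCKHom K B (NCK.graftMap d x)) [] = 0 := by
  suffices h : NCPoly.coeffₗ [] ∘ₗ (realizeNCKHom K B).toLinearMap ∘ₗ NCK.graftMap d = 0 from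
    LinearMap.congr_fun h x
  refine (NCK.E K D).ext fun F => ?_
  simp only [LinearMap.comp_apply, AlgHom.toLinearMap_apply, NCK.graftMap_E, realizeNCKHom_E]
  exact B.coeff_nil_forestPoly_of _

theorem forestPoly_rd_singleton (hB : IsUniform B) (t : Term (sigD D)) :
    B.forestPoly K (rd [t]) = realizeNCKHom K B (NCK.E K D t.toForest) := by
  induction t generalizing B with
  | leaf => rw [rd_leaf, B.forestPoly_one, Term.toForest, NCK.E_one, map_one]
  | node n g c ih =>
    rw [rd_of_ne (Term.node n g c) nofun, Term.toForest, ← NCK.graftMap_E]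
    refine NCPoly.ext_quot ?_ fun a => ?_
    · rw [B.coeff_nil_forestPoly_of, coeff_nil_realizeNCKHom_graftMap]
    · rw [quot_forestPoly_node hB, quot_realizeNCKHom_graftMap hB, ForestLike.forestPoly_rd,
        NCK.E_prod_ofFn, map_list_prod, List.map_ofFn, List.map_ofFn]
      simp only [Function.comp_def, ih _ (hB.withRoot _)]

theorem realizeHom_eq_comp (hB : IsUniform B) :
    B.realizeHom K = (realizeNCKHom K B).comp (NatHopf.toNCKHom K D) := by
  refine NatHopf.algHom_ext fun t => ?_
  rw [B.realizeHom_E, ← rd_of_ne t.1 t.2, forestPoly_rd_singleton hB, AlgHom.comp_apply,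
    NatHopf.toNCKHom_E_rd, List.map_singleton, List.prod_singleton]

end Uniform

/-! ### The doubling of alphabets -/

/-- The convolution product of families indexed by pairs of words, that is, the product of the
series on two alphabets commuting with each other. -/
def conv {R : Type*} [Semiring R] {A A' : Type*} (F G : List A × List A' → R) :
    List A × List A' → R := fun p =>
  ∑ i ∈ Finset.range (p.1.length + 1), ∑ j ∈ Finset.range (p.2.length + 1),
    F (p.1.take i, p.2.take j) * G (p.1.drop i, p.2.drop j)

theorem conv_add {R : Type*} [Semiring R] {A A' : Type*} (F G H : List A × List A' → R) :
    conv F (G + H) = conv F G + conv F H := by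
  ext p
  simp only [conv, Pi.add_apply, mul_add, Finset.sum_add_distrib]

theorem add_conv {R : Type*} [Semiring R] {A A' : Type*} (F G H : List A × List A' → R) :
    conv (F + G) H = conv F H + conv G H := by
  ext p
  simp only [conv, Pi.add_apply, add_mul, Finset.sum_add_distrib]

/-- The family whose value at `(a :: u, v)` is the value of `F a` at `(u, v)`, and whose values at
`([], v)` vanish. -/
def consLeft {R : Type*} [Zero R] {A A' : Type*} (F : A → List A × List A' → R) :
    List A × List A' → R
  | ([], _) => 0
  | (a :: u, v) => F a (u, v)

/-- The family whose value at `(u, b :: v)` is the value of `F b` at `(u, v)`, and whose values at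
`(u, [])` vanish. -/
def consRight {R : Type*} [Zero R] {A A' : Type*} (F : A' → List A × List A' → R) :
    List A × List A' → R
  | (_, []) => 0
  | (u, b :: v) => F b (u, v)

section

variable {K : Type v} [Field K] {A A' : Type u}

theorem consLeft_zero : consLeft (fun _ : A => (0 : List A × List A' → K)) = 0 := by
  ext ⟨_ | _, _⟩ <;> rfl

theorem evalTensor_tmul (p : NCPoly K A) (q : NCPoly K A') (u : List A) (v : List A') :
    evalTensor (p ⊗ₜ q) (u, v) = NCPoly.coeff p u * NCPoly.coeff q v := rfl

theorem evalTensor_mul (s t : NCPoly K A ⊗[K] NCPoly K A') :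
    evalTensor (s * t) = conv (evalTensor s) (evalTensor t) := by
  induction s with
  | zero => ext; simp [conv]
  | add s s' hs hs' => rw [add_mul, map_add, map_add, hs, hs', add_conv]
  | tmul p q =>
    induction t with
    | zero => ext; simp [conv]
    | add t t' ht ht' => rw [mul_add, map_add, map_add, ht, ht', conv_add]
    | tmul p' q' =>
      ext ⟨u, v⟩
      rw [Algebra.TensorProduct.tmul_mul_tmul, evalTensor_tmul, NCPoly.coeff_mul,
        NCPoly.coeff_mul, Finset.sum_mul_sum, conv]
      simp only [evalTensor_tmul, mul_mul_mul_comm]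

theorem rightPart_nil : rightPart ([] : List (A ⊕ A')) = [] := rfl

theorem leftPart_inl_cons (a : A) (w : List (A ⊕ A')) :
    leftPart (.inl a :: w) = a :: leftPart w := rfl

theorem leftPart_inr_cons (b : A') (w : List (A ⊕ A')) :
    leftPart (.inr b :: w) = leftPart w := rfl

theorem rightPart_inl_cons (a : A) (w : List (A ⊕ A')) :
    rightPart (.inl a :: w) = rightPart w := rfl

theorem rightPart_inr_cons (b : A') (w : List (A ⊕ A')) :
    rightPart (.inr b :: w) = b :: rightPart w := rfl

theorem leftPart_append (w w' : List (A ⊕ A')) :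
    leftPart (w ++ w') = leftPart w ++ leftPart w' := List.filterMap_append

theorem rightPart_append (w w' : List (A ⊕ A')) :
    rightPart (w ++ w') = rightPart w ++ rightPart w' := List.filterMap_append

theorem mem_restrictions {w : List (A ⊕ A')} {u : List A} {v : List A'} :
    w ∈ (finite_restrictions (u, v)).toFinset ↔ leftPart w = u ∧ rightPart w = v :=
  Set.Finite.mem_toFinset _

theorem theta_mul (p q : NCPoly K (A ⊕ A')) : theta (p * q) = conv (theta p) (theta q) := by
  ext ⟨u, v⟩
  simp only [theta, conv, NCPoly.coeff_mul, Finset.sum_mul_sum, ← Finset.sum_product']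
  rw [Finset.sum_sigma', Finset.sum_sigma']
  refine Finset.sum_nbij'
    (fun x => ⟨((leftPart (x.1.take x.2)).length, (rightPart (x.1.take x.2)).length),
      (x.1.take x.2, x.1.drop x.2)⟩)
    (fun x => ⟨x.2.1 ++ x.2.2, x.2.1.length⟩) ?_ ?_ ?_ ?_ fun _ _ => rfl
  · rintro ⟨w, i⟩ h
    simp only [Finset.mem_sigma, Finset.mem_product, mem_restrictions, Finset.mem_range] at h ⊢
    obtain ⟨⟨hu, hv⟩, -⟩ := h
    rw [← List.take_append_drop i w, leftPart_append] at hu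
    rw [← List.take_append_drop i w, rightPart_append] at hv
    subst hu hv
    simp
  · rintro ⟨⟨i, j⟩, w, w'⟩ h
    simp only [Finset.mem_sigma, Finset.mem_product, mem_restrictions, Finset.mem_range] at h ⊢
    obtain ⟨-, ⟨hu, hv⟩, hu', hv'⟩ := h
    rw [leftPart_append, rightPart_append, hu, hv, hu', hv']
    simp
  · rintro ⟨w, i⟩ h
    simp only [Finset.mem_sigma, Finset.mem_range, Nat.lt_succ_iff] at h
    simp [h.2]
  · rintro ⟨⟨i, j⟩, w, w'⟩ h
    simp only [Finset.mem_sigma, Finset.mem_product, mem_restrictions, Finset.mem_range,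
      Nat.lt_succ_iff] at h
    obtain ⟨⟨hi, hj⟩, ⟨hu, hv⟩, -⟩ := h
    simp [hu, hv, hi, hj]

variable (K A A') in
/-- The alphabet-splitting map `theta` as a linear map. -/
def thetaₗ : NCPoly K (A ⊕ A') →ₗ[K] (List A × List A' → K) where
  toFun := theta
  map_add' _ _ := funext fun _ => Finset.sum_add_distrib
  map_smul' _ _ := funext fun _ => (Finset.mul_sum _ _ _).symm

theorem theta_ite {P Q : Prop} {_ : Decidable P} {_ : Decidable Q} (hPQ : P ↔ Q)
    {p : NCPoly K (A ⊕ A')} {s : NCPoly K A ⊗[K] NCPoly K A'} (h : theta p = evalTensor s) :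
    theta (if P then p else 0) = evalTensor (if Q then s else 0) := by
  rw [apply_ite theta, apply_ite evalTensor, map_zero, h]
  exact if_congr hPQ rfl (map_zero (thetaₗ K A A'))

theorem theta_one : theta (1 : NCPoly K (A ⊕ A')) = evalTensor (1 ⊗ₜ[K] 1) := by
  classical
  ext ⟨u, v⟩
  rw [theta, evalTensor_tmul]
  simp only [NCPoly.coeff_one, Finset.sum_ite_eq', mem_restrictions, ite_zero_mul_ite_zero, mul_one]
  exact if_congr (and_congr eq_comm eq_comm) rfl rfl

theorem theta_algebraMap (r : K) : theta (algebraMap K (NCPoly K (A ⊕ A')) r) =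
    evalTensor (algebraMap K (NCPoly K A ⊗[K] NCPoly K A') r) := by
  rw [Algebra.algebraMap_eq_smul_one, Algebra.algebraMap_eq_smul_one, map_smul,
    Algebra.TensorProduct.one_def, ← theta_one]
  exact map_smul (thetaₗ K A A') r 1

theorem theta_eq_consLeft_add_consRight {p : NCPoly K (A ⊕ A')} (hp : NCPoly.coeff p [] = 0) :
    theta p = consLeft (fun a => theta (NCPoly.quot (.inl a) p)) +
      consRight (fun b => theta (NCPoly.quot (.inr b) p)) := by
  classical
  ext ⟨u, v⟩
  rw [theta, Pi.add_apply,
    ← Finset.sum_filter_add_sum_filter_not _ (fun w => ∃ a w', w = Sum.inl a :: w')]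
  congr 1
  · cases u with
    | nil =>
      refine Finset.sum_eq_zero fun w hw => ?_
      obtain ⟨hw, a, w, rfl⟩ := Finset.mem_filter.mp hw
      exact absurd (mem_restrictions.mp hw).1 nofun
    | cons a u =>
      suffices h : (finite_restrictions (a :: u, v)).toFinset.filter
          (fun w => ∃ a w', w = Sum.inl a :: w') =
            (finite_restrictions (u, v)).toFinset.map ⟨_, List.cons_injective (a := .inl a)⟩ by
        rw [h, Finset.sum_map]
        rfl
      ext w
      rcases w with _ | ⟨x | x, w⟩ <;>
        simp only [Finset.mem_filter, mem_restrictions, Finset.mem_map,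
          Function.Embedding.coeFn_mk, leftPart_inl_cons, rightPart_inl_cons] <;> grind
  · cases v with
    | nil =>
      refine Finset.sum_eq_zero fun w hw => ?_
      obtain ⟨hw, h_left⟩ := Finset.mem_filter.mp hw
      rcases w with _ | ⟨x | x, w⟩
      · exact hp
      · exact absurd ⟨x, w, rfl⟩ h_left
      · exact absurd (mem_restrictions.mp hw).2 nofun
    | cons b v =>
      suffices h : (finite_restrictions (u, b :: v)).toFinset.filter
          (fun w => ¬∃ a w', w = Sum.inl a :: w') =
            (finite_restrictions (u, v)).toFinset.map ⟨_, List.cons_injective (a := .inr b)⟩ by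
        rw [h, Finset.sum_map]
        rfl
      ext w
      rcases w with _ | ⟨x | x, w⟩ <;>
        simp only [Finset.mem_filter, mem_restrictions, Finset.mem_map, rightPart_nil,
          Function.Embedding.coeFn_mk, leftPart_inr_cons, rightPart_inr_cons] <;> grind

theorem evalTensor_nil (s : NCPoly K A ⊗[K] NCPoly K A') (v : List A') : evalTensor s ([], v) =
    NCPoly.coeff (TensorProduct.lid K _ ((NCPoly.coeffₗ []).rTensor (NCPoly K A') s)) v := by
  induction s with
  | zero => simp only [map_zero]; rfl
  | add s t hs ht => simp only [map_add, Pi.add_apply, hs, ht]; rfl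
  | tmul p q => rfl

theorem evalTensor_cons (s : NCPoly K A ⊗[K] NCPoly K A') (a : A) (u : List A) (v : List A') :
    evalTensor s (a :: u, v) = evalTensor ((NCPoly.quot a).rTensor (NCPoly K A') s) (u, v) := by
  induction s with
  | zero => simp only [map_zero]; rfl
  | add s t hs ht => simp only [map_add, Pi.add_apply, hs, ht]
  | tmul p q => rfl

theorem evalTensor_eq_consLeft {s : NCPoly K A ⊗[K] NCPoly K A'}
    (hs : (NCPoly.coeffₗ []).rTensor (NCPoly K A') s = 0) :
    evalTensor s = consLeft fun a => evalTensor ((NCPoly.quot a).rTensor (NCPoly K A') s) := by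
  ext ⟨u, v⟩
  cases u with
  | nil => rw [evalTensor_nil, hs, map_zero]; rfl
  | cons a u => exact evalTensor_cons s a u v

theorem evalTensor_one_tmul_eq_consRight {q : NCPoly K A'} (hq : NCPoly.coeff q [] = 0) :
    evalTensor ((1 : NCPoly K A) ⊗ₜ[K] q) =
      consRight fun b => evalTensor ((1 : NCPoly K A) ⊗ₜ[K] NCPoly.quot b q) := by
  ext ⟨u, v⟩
  cases v with
  | nil => rw [evalTensor_tmul, hq, mul_zero]; rfl
  | cons b v => rfl

end

section

variable {K : Type v} [Field K] {D : Type u} {A A' : Type u} {B : ForestLike (sigD D) A}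
  {B' : ForestLike (sigD D) A'}

theorem isUniform_sum (hB : IsUniform B) (hB' : IsUniform B') : IsUniform (B.sum B') := by
  constructor
  · intro d n n'
    ext (a | a)
    · exact iff_of_eq (congrFun (hB.1 d n n') a)
    · exact iff_of_eq (congrFun (hB'.1 d n n') a)
  · intro j j'
    ext (a | a) (b | b)
    · exact iff_of_eq (congrFun₂ (hB.2 j j') a b)
    · rfl
    · rfl
    · exact iff_of_eq (congrFun₂ (hB'.2 j j') a b)

theorem sum_withRoot_edge_inl (B : ForestLike (sigD D) A) (B' : ForestLike (sigD D) A') (a : A) :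
    (B.sum B').withRoot ((B.sum B').edge 0 (.inl a)) = (B.withRoot (B.edge 0 a)).sum B' := by
  simp only [ForestLike.withRoot, ForestLike.sum, ForestLike.mk.injEq, and_true]
  ext (_ | _) <;> rfl

theorem sum_withRoot_edge_inr (B : ForestLike (sigD D) A) (B' : ForestLike (sigD D) A') (b : A') :
    (B.sum B').withRoot ((B.sum B').edge 0 (.inr b)) =
      (B.sum B').withRoot (Sum.elim (fun _ => False) (B'.edge 0 b)) := by
  refine congrArg _ ?_
  ext (_ | _) <;> rfl

theorem theta_realizeNCKHom_withRoot (hB : IsUniform B) (hB' : IsUniform B') (R' : A' → Prop)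
    (x : NCK K D) :
    theta (realizeNCKHom K ((B.sum B').withRoot (Sum.elim (fun _ => False) R')) x) =
      evalTensor (1 ⊗ₜ realizeNCKHom K (B'.withRoot R') x) := by
  induction x using NCK.induction generalizing R' with
  | algebraMap r =>
    rw [AlgHom.commutes, AlgHom.commutes, theta_algebraMap, Algebra.TensorProduct.algebraMap_apply,
      Algebra.algebraMap_eq_smul_one, Algebra.algebraMap_eq_smul_one, TensorProduct.smul_tmul]
  | add x y hx hy =>
    rw [map_add, map_add, TensorProduct.tmul_add, map_add, ← hx, ← hy]
    exact map_add (thetaₗ K A A') _ _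
  | mul x y hx hy =>
    rw [map_mul, map_mul, theta_mul, hx, hy, ← evalTensor_mul,
      Algebra.TensorProduct.tmul_mul_tmul, one_mul]
  | graft d x ih =>
    have h_sum := (isUniform_sum hB hB').withRoot (Sum.elim (fun _ => False) R')
    rw [theta_eq_consLeft_add_consRight (coeff_nil_realizeNCKHom_graftMap d x),
      evalTensor_one_tmul_eq_consRight (coeff_nil_realizeNCKHom_graftMap d x)]
    have h_left (a : A) : theta (NCPoly.quot (.inl a) (realizeNCKHom K
        ((B.sum B').withRoot (Sum.elim (fun _ => False) R')) (NCK.graftMap d x))) = 0 := by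
      rw [quot_realizeNCKHom_graftMap h_sum, if_neg fun h => h.1]
      exact map_zero (thetaₗ K A A')
    simp only [h_left, consLeft_zero, zero_add]
    refine congrArg consRight (funext fun b => ?_)
    rw [quot_realizeNCKHom_graftMap h_sum, quot_realizeNCKHom_graftMap (hB'.withRoot R'),
      TensorProduct.tmul_ite]
    refine theta_ite Iff.rfl (.trans ?_ (ih (B'.edge 0 b)))
    exact congrArg (fun C => theta (realizeNCKHom K C x)) (sum_withRoot_edge_inr B B' b)

theorem rTensor_coeffₗ_nil_map_realizeNCKHom (d : D) (y : NCK K D ⊗[K] NCK K D) :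
    (NCPoly.coeffₗ []).rTensor (NCPoly K A') (Algebra.TensorProduct.map (realizeNCKHom K B)
      (realizeNCKHom K B') ((NCK.graftMap d).rTensor (NCK K D) y)) = 0 := by
  induction y with
  | zero => simp only [map_zero]
  | add y z hy hz => simp only [map_add, hy, hz, add_zero]
  | tmul x y =>
    rw [LinearMap.rTensor_tmul, Algebra.TensorProduct.map_tmul, LinearMap.rTensor_tmul]
    exact (congrArg (· ⊗ₜ _) (coeff_nil_realizeNCKHom_graftMap d x)).trans
      (TensorProduct.zero_tmul _ _)

open Classical in
theorem rTensor_quot_map_realizeNCKHom (hB : IsUniform B) (d : D) (y : NCK K D ⊗[K] NCK K D)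
    (a : A) :
    (NCPoly.quot a).rTensor (NCPoly K A') (Algebra.TensorProduct.map (realizeNCKHom K B)
      (realizeNCKHom K B') ((NCK.graftMap d).rTensor (NCK K D) y)) =
      if B.root a ∧ B.dec 0 d a then
        Algebra.TensorProduct.map (realizeNCKHom K (B.withRoot (B.edge 0 a)))
          (realizeNCKHom K B') y else 0 := by
  induction y with
  | zero => simp only [map_zero, ite_self]
  | add y z hy hz => simp only [map_add, hy, hz]; split_ifs <;> simp only [add_zero]
  | tmul x y =>
    rw [LinearMap.rTensor_tmul, Algebra.TensorProduct.map_tmul, LinearMap.rTensor_tmul,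
      quot_realizeNCKHom_graftMap hB]
    split_ifs
    · rw [Algebra.TensorProduct.map_tmul]
    · rw [TensorProduct.zero_tmul]

/-- The key to the compatibility with the coproduct: since no edge goes from a letter of `A'` to a
letter of `A`, the first letter of a word compatible with a tree is either in `A'`, and then the
whole word is, or in `A`, and then the rest of the word is treated by induction. -/
theorem theta_realizeNCKHom (hB : IsUniform B) (hB' : IsUniform B') (x : NCK K D) :
    theta (realizeNCKHom K (B.sum B') x) =
      evalTensor (Algebra.TensorProduct.map (realizeNCKHom K B) (realizeNCKHom K B')
        (NCK.comulOppHom K D x)) := by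
  induction x using NCK.induction generalizing B with
  | algebraMap r => simp only [AlgHom.commutes, theta_algebraMap]
  | add x y hx hy =>
    simp only [map_add, ← hx hB, ← hy hB]
    exact map_add (thetaₗ K A A') _ _
  | mul x y hx hy => rw [map_mul, map_mul, map_mul, theta_mul, evalTensor_mul, hx hB, hy hB]
  | graft d x ih =>
    rw [theta_eq_consLeft_add_consRight (coeff_nil_realizeNCKHom_graftMap d x),
      NCK.comulOppHom_graftMap, map_add, map_add, add_comm, Algebra.TensorProduct.map_tmul,
      map_one, evalTensor_one_tmul_eq_consRight (coeff_nil_realizeNCKHom_graftMap d x),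
      evalTensor_eq_consLeft]
    · congr 1
      · refine congrArg consRight (funext fun b => ?_)
        rw [quot_realizeNCKHom_graftMap (isUniform_sum hB hB'), quot_realizeNCKHom_graftMap hB',
          sum_withRoot_edge_inr, TensorProduct.tmul_ite]
        exact theta_ite Iff.rfl <| theta_realizeNCKHom_withRoot hB hB' _ x
      · refine congrArg consLeft (funext fun a => ?_)
        rw [quot_realizeNCKHom_graftMap (isUniform_sum hB hB'),
          rTensor_quot_map_realizeNCKHom hB, sum_withRoot_edge_inl]
        exact theta_ite Iff.rfl <| ih (hB.withRoot _)
    · exact rTensor_coeffₗ_nil_map_realizeNCKHom d _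

end

namespace ForestLike

variable {S : ℕ → Type u} {A A' : Type u}

/-- The forest-like structure obtained by pulling back the relations of `B` along `e`. -/
def comap (e : A → A') (B : ForestLike S A') : ForestLike S A where
  root a := B.root (e a)
  dec n g a := B.dec n g (e a)
  edge j a b := B.edge j (e a) (e b)

theorem compatible_comap {e : A → A'} {B : ForestLike S A'} {f : RForest S} {w : List A} :
    (B.comap e).Compatible f w ↔ B.Compatible f (w.map e) := by
  have h_getElem (i : ℕ) (y : A') :
      (w.map e)[i]? = some y ↔ ∃ x, w[i]? = some x ∧ e x = y := by simp
  constructor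
  · rintro ⟨h_length, h_root, h_dec, h_edge⟩
    simp only [comap] at h_root h_dec h_edge
    exact ⟨by rwa [List.length_map], by grind [comap], by grind [comap], by grind [comap]⟩
  · rintro ⟨h_length, h_root, h_dec, h_edge⟩
    exact ⟨by rwa [List.length_map] at h_length, by grind [comap], by grind [comap],
      by grind [comap]⟩

theorem sumOpp_eq_comap (B : ForestLike S A) (B' : ForestLike S A') :
    B.sumOpp B' = (B'.sum B).comap Sum.swap := rfl

end ForestLike

section

variable {K : Type v} [Field K] {D : Type u} {A A' : Type u}

theorem coeff_realizeNCKHom_comap (e : A → A') (B : ForestLike (sigD D) A') (x : NCK K D)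
    (w : List A) : NCPoly.coeff (realizeNCKHom K (B.comap e) x) w =
      NCPoly.coeff (realizeNCKHom K B x) (w.map e) := by
  classical
  suffices h : NCPoly.coeffₗ w ∘ₗ (realizeNCKHom K (B.comap e)).toLinearMap =
      NCPoly.coeffₗ (w.map e) ∘ₗ (realizeNCKHom K B).toLinearMap from LinearMap.congr_fun h x
  refine (NCK.E K D).ext fun F => ?_
  change NCPoly.coeff (realizeNCKHom K (B.comap e) _) w = NCPoly.coeff (realizeNCKHom K B _) _
  rw [realizeNCKHom_E, realizeNCKHom_E, ForestLike.coeff_forestPoly, ForestLike.coeff_forestPoly]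
  exact if_congr ForestLike.compatible_comap rfl rfl

theorem leftPart_map_swap (w : List (A ⊕ A')) : leftPart (w.map Sum.swap) = rightPart w := by
  induction w with
  | nil => rfl
  | cons x w ih => cases x with
    | inl a => exact ih
    | inr a => exact congrArg (a :: ·) ih

theorem rightPart_map_swap (w : List (A ⊕ A')) : rightPart (w.map Sum.swap) = leftPart w := by
  rw [← leftPart_map_swap, List.map_map, Sum.swap_swap_eq, List.map_id]

theorem theta_realizeNCKHom_sumOpp_apply (B : ForestLike (sigD D) A) (B' : ForestLike (sigD D) A')
    (x : NCK K D) (u : List A) (v : List A') :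
    theta (realizeNCKHom K (B.sumOpp B') x) (u, v) =
      theta (realizeNCKHom K (B'.sum B) x) (v, u) := by
  refine Finset.sum_nbij' (List.map Sum.swap) (List.map Sum.swap) ?_ ?_ ?_ ?_ fun w _ => ?_
  · intro w hw
    rw [mem_restrictions] at hw ⊢
    rw [leftPart_map_swap, rightPart_map_swap, hw.1, hw.2]
    exact ⟨rfl, rfl⟩
  · intro w hw
    rw [mem_restrictions] at hw ⊢
    rw [leftPart_map_swap, rightPart_map_swap, hw.1, hw.2]
    exact ⟨rfl, rfl⟩
  · exact fun w _ => by rw [List.map_map, Sum.swap_swap_eq, List.map_id]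
  · exact fun w _ => by rw [List.map_map, Sum.swap_swap_eq, List.map_id]
  · rw [ForestLike.sumOpp_eq_comap, coeff_realizeNCKHom_comap]

theorem evalTensor_comm (s : NCPoly K A ⊗[K] NCPoly K A') (u : List A) (v : List A') :
    evalTensor (TensorProduct.comm K _ _ s) (v, u) = evalTensor s (u, v) := by
  induction s with
  | zero => rw [LinearEquiv.map_zero, map_zero, map_zero]; rfl
  | add s t hs ht => rw [LinearEquiv.map_add, map_add, map_add, Pi.add_apply, hs, ht]; rfl
  | tmul p q => exact mul_comm _ _

theorem theta_realizeNCKHom_sumOpp {B : ForestLike (sigD D) A} {B' : ForestLike (sigD D) A'}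
    (hB : IsUniform B) (hB' : IsUniform B') (x : NCK K D) :
    theta (realizeNCKHom K (B.sumOpp B') x) =
      evalTensor (Algebra.TensorProduct.map (realizeNCKHom K B) (realizeNCKHom K B')
        (CoalgebraStruct.comul (R := K) x)) := by
  ext ⟨u, v⟩
  rw [theta_realizeNCKHom_sumOpp_apply, theta_realizeNCKHom hB' hB]
  exact (congrArg (fun s => evalTensor s (v, u)) (TensorProduct.map_comm
    (realizeNCKHom K B').toLinearMap (realizeNCKHom K B).toLinearMap
    (CoalgebraStruct.comul x))).trans (evalTensor_comm _ u v)

theorem isUniform_comap {e : A → A'} {B : ForestLike (sigD D) A'} (hB : IsUniform B) :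
    IsUniform (B.comap e) :=
  ⟨fun d n n' => funext fun a => congrFun (hB.1 d n n') (e a),
    fun j j' => funext₂ fun a b => congrFun₂ (hB.2 j j') (e a) (e b)⟩

end

/-! ### Injectivity of the realization -/

/-- The letters `(d, k)` for the nodes of a tree in preorder, where `d` is the decoration of the
node and `k` its depth increased by `h`. -/
def PTree.depthWord {D : Type u} : PTree D → ℕ → List (D × ℕ)
  | node d _ c, h => (d, h) :: (List.ofFn fun i => depthWord (c i) (h + 1)).flatten

namespace PForest

variable {D : Type u}

/-- The concatenation of the words `PTree.depthWord` of the trees of a forest. For `h = 0`, it is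
the least word compatible with the forest. -/
def depthWord (h : ℕ) (F : PForest D) : List (D × ℕ) := F.toList.flatMap (PTree.depthWord · h)

theorem depthWord_of_graft (h : ℕ) (d : D) (F : PForest D) :
    depthWord h (FreeMonoid.of (PTree.graft d F.toList)) = (d, h) :: depthWord (h + 1) F := by
  rw [depthWord, FreeMonoid.toList_of, List.flatMap_singleton, PTree.graft, PTree.depthWord,
    depthWord, List.flatMap_def]
  exact congrArg (fun l => (d, h) :: List.flatten l)
    (List.ofFn_getElem_eq_map F.toList (PTree.depthWord · (h + 1)))

theorem depthWord_mul (h : ℕ) (F G : PForest D) :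
    depthWord h (F * G) = depthWord h F ++ depthWord h G := List.flatMap_append

theorem depthWord_of_graft_mul (h : ℕ) (d : D) (F G : PForest D) :
    depthWord h (FreeMonoid.of (PTree.graft d F.toList) * G) =
      (d, h) :: (depthWord (h + 1) F ++ depthWord h G) := by
  rw [depthWord_mul, depthWord_of_graft, List.cons_append]

theorem le_of_mem_depthWord (h : ℕ) (F : PForest D) : ∀ a ∈ depthWord h F, h ≤ a.2 := by
  induction F using PForest.induction generalizing h with
  | one => exact nofun
  | graft d F ih =>
    rw [depthWord_of_graft, List.forall_mem_cons]
    exact ⟨le_rfl, fun a ha => Nat.le_of_succ_le (ih (h + 1) a ha)⟩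
  | mul F G hF hG =>
    rw [depthWord_mul, List.forall_mem_append]
    exact ⟨hF h, hG h⟩

@[elab_as_elim]
theorem consInduction {P : PForest D → Prop} (one : P 1)
    (cons : ∀ d F G, P F → P G → P (FreeMonoid.of (PTree.graft d F.toList) * G))
    (F : PForest D) : P F := by
  suffices h : ∀ G, P G → P (F * G) from mul_one F ▸ h 1 one
  induction F using PForest.induction with
  | one => exact fun G hG => (one_mul G).symm ▸ hG
  | graft d F ih => exact fun G => cons d F G (mul_one F ▸ ih 1 one)
  | mul F F' hF hF' => exact fun G hG => mul_assoc F F' G ▸ hF _ (hF' G hG)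

theorem takeWhile_depthWord (h : ℕ) (F G : PForest D) :
    (depthWord (h + 1) F ++ depthWord h G).takeWhile (h < ·.2) = depthWord (h + 1) F := by
  rw [List.takeWhile_append_of_pos fun a ha =>
    decide_eq_true (Nat.lt_of_succ_le (le_of_mem_depthWord (h + 1) F a ha))]
  induction G using PForest.consInduction with
  | one => exact List.append_nil _
  | cons d G G' => rw [depthWord_of_graft_mul, List.takeWhile_cons_of_neg (by simp),
      List.append_nil]

/-- The letters of the subtrees of the first root are recognized as those which precede the next
letter `(d, h)`. -/
theorem depthWord_injective (h : ℕ) : Function.Injective (depthWord h : PForest D → _) := by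
  intro F
  induction F using PForest.consInduction generalizing h with
  | one =>
    intro G hG
    induction G using PForest.consInduction with
    | one => rfl
    | cons d G G' => rw [depthWord_of_graft_mul] at hG; exact absurd hG nofun
  | cons d F F' hF hF' =>
    intro G hG
    induction G using PForest.consInduction with
    | one => rw [depthWord_of_graft_mul] at hG; exact absurd hG nofun
    | cons e G G' =>
      rw [depthWord_of_graft_mul, depthWord_of_graft_mul, List.cons.injEq, Prod.mk.injEq] at hG
      obtain ⟨⟨rfl, -⟩, hFG⟩ := hG
      have h_take : depthWord (h + 1) F = depthWord (h + 1) G := by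
        rw [← takeWhile_depthWord h F F', hFG, takeWhile_depthWord]
      rw [h_take, List.append_cancel_left_eq] at hFG
      rw [hF _ h_take, hF' _ hFG]

end PForest

section

variable {K : Type v} [Field K] {D : Type u}

theorem isUniform_alphD : IsUniform (alphD D) := ⟨fun _ _ _ => rfl, fun _ _ => rfl⟩

theorem forall₂_depthWord_of_coeff_ne_zero {F : PForest D} {h : ℕ} {R : D × ℕ → Prop}
    (hR : ∀ a, R a → h ≤ a.2) {w : List (D × ℕ)}
    (hw : NCPoly.coeff (realizeNCKHom K ((alphD D).withRoot R) (NCK.E K D F)) w ≠ 0) :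
    List.Forall₂ (fun a b => a.1 = b.1 ∧ a.2 ≤ b.2) (F.depthWord h) w := by
  classical
  induction F using PForest.induction generalizing h R w with
  | one =>
    rw [NCK.E_one, map_one, NCPoly.coeff_one, ite_ne_right_iff] at hw
    exact hw.1 ▸ List.Forall₂.nil
  | graft d F ih =>
    rw [← NCK.graftMap_E] at hw
    cases w with
    | nil => exact absurd (coeff_nil_realizeNCKHom_graftMap d _) hw
    | cons a w =>
      rw [← NCPoly.coeff_quot, quot_realizeNCKHom_graftMap (isUniform_alphD.withRoot R)] at hw
      split_ifs at hw with ha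
      · rw [PForest.depthWord_of_graft]
        refine .cons ⟨ha.2.symm, hR a ha.1⟩ (ih (fun b hb => ?_) hw)
        exact (Nat.succ_le_succ (hR a ha.1)).trans hb
      · exact absurd rfl hw
  | mul F G hF hG =>
    rw [NCK.E_mul, map_mul, NCPoly.coeff_mul] at hw
    obtain ⟨i, -, hi⟩ := Finset.exists_ne_zero_of_sum_ne_zero hw
    rw [PForest.depthWord_mul, ← List.take_append_drop i w]
    exact List.rel_append (hF hR (left_ne_zero_of_mul hi)) (hG hR (right_ne_zero_of_mul hi))

theorem coeff_depthWord (F : PForest D) (h : ℕ) (R : D × ℕ → Prop) (hR : ∀ a, R a ↔ h ≤ a.2) :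
    NCPoly.coeff (realizeNCKHom K ((alphD D).withRoot R) (NCK.E K D F)) (F.depthWord h) = 1 := by
  classical
  induction F using PForest.induction generalizing h R with
  | one => rw [NCK.E_one, map_one]; rfl
  | graft d F ih =>
    rw [← NCK.graftMap_E, PForest.depthWord_of_graft, ← NCPoly.coeff_quot,
      quot_realizeNCKHom_graftMap (isUniform_alphD.withRoot R), if_pos ⟨(hR _).mpr le_rfl, rfl⟩]
    exact ih _ _ fun a => Iff.rfl
  | mul F G hF hG =>
    rw [NCK.E_mul, map_mul, NCPoly.coeff_mul, PForest.depthWord_mul,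
      Finset.sum_eq_single (F.depthWord h).length]
    · rw [List.take_left, List.drop_left, hF h R hR, hG h R hR, one_mul]
    · intro i hi hne
      by_contra hi'
      refine hne ?_
      have h_length := (forall₂_depthWord_of_coeff_ne_zero (fun a => (hR a).mp)
        (left_ne_zero_of_mul hi')).length_eq
      grind
    · intro h_not_mem
      exact absurd (by simp) h_not_mem

theorem sum_snd_le_sum_snd {u w : List (D × ℕ)}
    (h : List.Forall₂ (fun a b => a.1 = b.1 ∧ a.2 ≤ b.2) u w) :
    (u.map Prod.snd).sum ≤ (w.map Prod.snd).sum :=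
  List.Forall₂.sum_le_sum <| List.forall₂_map_left_iff.mpr <| List.forall₂_map_right_iff.mpr <|
    h.imp fun _ _ => And.right

theorem eq_of_forall₂_of_sum_snd_le {u w : List (D × ℕ)}
    (h : List.Forall₂ (fun a b => a.1 = b.1 ∧ a.2 ≤ b.2) u w)
    (h_sum : (w.map Prod.snd).sum ≤ (u.map Prod.snd).sum) : u = w := by
  induction h with
  | nil => rfl
  | cons hab h ih =>
    have := sum_snd_le_sum_snd h
    simp only [List.map_cons, List.sum_cons] at h_sum
    rw [ih (by lia), Prod.ext hab.1 (by lia)]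

variable (K D) in
/-- The realization is unitriangular with respect to the total depth of the forests. -/
theorem realizeNCKHom_alphD_injective : Function.Injective (realizeNCKHom K (alphD D)) := by
  classical
  rw [injective_iff_map_eq_zero]
  intro x hx
  by_contra hne
  have h_support : ((NCK.E K D).repr x).support.Nonempty := by
    rwa [Finsupp.support_nonempty_iff, (NCK.E K D).repr.map_ne_zero_iff]
  obtain ⟨F, hF, h_min⟩ := Finset.exists_min_image _
    (fun F : PForest D => ((F.depthWord 0).map Prod.snd).sum) h_support
  have h_one : NCPoly.coeffₗ (F.depthWord 0) (realizeNCKHom K (alphD D) (NCK.E K D F)) = 1 :=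
    coeff_depthWord F 0 (fun _ => True) fun a => iff_of_true trivial (Nat.zero_le a.2)
  have h_coeff (G : PForest D) (hG : G ∈ ((NCK.E K D).repr x).support) (hGF : G ≠ F) :
      NCPoly.coeffₗ (F.depthWord 0) (realizeNCKHom K (alphD D) (NCK.E K D G)) = 0 := by
    by_contra h
    have h_le := forall₂_depthWord_of_coeff_ne_zero (R := fun _ => True)
      (fun a _ => Nat.zero_le a.2) h
    exact hGF (PForest.depthWord_injective 0 (eq_of_forall₂_of_sum_snd_le h_le (h_min G hG)))
  have h_zero : NCPoly.coeffₗ (F.depthWord 0) (realizeNCKHom K (alphD D) x) = 0 := by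
    rw [hx, map_zero]
  rw [← (NCK.E K D).linearCombination_repr x, Finsupp.linearCombination_apply, Finsupp.sum,
    map_sum, map_sum, Finset.sum_eq_single_of_mem F hF fun G hG hGF => ?_] at h_zero
  · rw [map_smul, map_smul, h_one, smul_eq_mul, mul_one] at h_zero
    exact Finsupp.mem_support_iff.mp hF h_zero
  · rw [map_smul, map_smul, h_coeff G hG hGF, smul_zero]

end

/-! ### The polynomial realizations -/

section Transport

variable {R H H' : Type*} [CommRing R] [Ring H] [Algebra R H] [Ring H'] [Algebra R H']
  [CoalgebraStruct R H]

/-- The coalgebra operations of `H` transported to `H'` along an isomorphism. -/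
abbrev transportCoalgebraStruct (e : H ≃ₐ[R] H') : CoalgebraStruct R H' where
  comul := TensorProduct.map e.toLinearMap e.toLinearMap ∘ₗ CoalgebraStruct.comul ∘ₗ
    e.symm.toLinearMap
  counit := CoalgebraStruct.counit ∘ₗ e.symm.toLinearMap

variable (e : H ≃ₐ[R] H')

theorem counit_transportCoalgebraStruct (x : H) :
    (transportCoalgebraStruct e).counit (e x) = CoalgebraStruct.counit x :=
  congrArg CoalgebraStruct.counit (e.symm_apply_apply x)

theorem comul_transportCoalgebraStruct (x : H) : (transportCoalgebraStruct e).comul (e x) =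
    TensorProduct.map e.toLinearMap e.toLinearMap (CoalgebraStruct.comul x) :=
  congrArg (fun y => TensorProduct.map e.toLinearMap e.toLinearMap (CoalgebraStruct.comul y))
    (e.symm_apply_apply x)

/-- An algebra isomorphism `H ≃ₐ[R] H'` as an isomorphism onto `H'` with the transported
operations. -/
def transportBialgEquiv : let _ := transportCoalgebraStruct e; H ≃ₐc[R] H' :=
  let _ := transportCoalgebraStruct e
  { e with
    map_smul' := map_smul e
    counit_comp := LinearMap.ext (counit_transportCoalgebraStruct e)
    map_comp_comul := LinearMap.ext fun x => (comul_transportCoalgebraStruct e x).symm }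

end Transport

theorem PTree.dg_toTerm {D : Type u} : ∀ t : PTree D, t.toTerm.dg = t.size
  | node _ _ c => congrArg (1 + ·) (Finset.sum_congr rfl fun i _ => dg_toTerm (c i))

theorem PForest.dg_toRForest {D : Type u} (F : PForest D) : (toRForest F).dg = F.size := by
  induction F using FreeMonoid.inductionOn' with
  | one => rfl
  | of_mul t F ih =>
    rw [map_mul, RForest.dg_mul, ih, PForest.size_mul, toRForest, FreeMonoid.map_of,
      RForest.dg_of, PTree.dg_toTerm]
    rfl

theorem isHomogeneous_realizeNCKHom {K : Type v} [Field K] {D A : Type u}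
    (B : ForestLike (sigD D) A) {n : ℕ} {x : NCK K D} (hx : x ∈ NCK.component K D n) :
    NCPoly.IsHomogeneous (realizeNCKHom K B x) n := by
  classical
  intro w
  contrapose!
  intro hw
  change x ∈ LinearMap.ker (NCPoly.coeffₗ w ∘ₗ (realizeNCKHom K B).toLinearMap)
  refine Submodule.span_le.mpr ?_ hx
  rintro _ ⟨F, hF, rfl⟩
  change NCPoly.coeff (realizeNCKHom K B _) w = 0
  rw [realizeNCKHom_E, B.coeff_forestPoly, if_neg]
  exact fun h => hw (h.length_eq.trans ((PForest.dg_toRForest F).trans hF))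

section

variable {S : ℕ → Type u} {A A' A'' : Type u} (B : ForestLike S A) (B' : ForestLike S A')
  (B'' : ForestLike S A'')

theorem isIso_sumAssoc :
    ForestLike.IsIso (Equiv.sumAssoc A A' A'') ((B.sum B').sum B'') (B.sum (B'.sum B'')) where
  root_iff := by rintro ((a | a) | a) <;> exact Iff.rfl
  dec_iff := by rintro n g ((a | a) | a) <;> exact Iff.rfl
  edge_iff := by rintro j ((a | a) | a) ((b | b) | b) <;> exact Iff.rfl

theorem isIso_sumAssoc_sumOpp :
    ForestLike.IsIso (Equiv.sumAssoc A A' A'') ((B.sumOpp B').sumOpp B'')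
      (B.sumOpp (B'.sumOpp B'')) where
  root_iff := by rintro ((a | a) | a) <;> exact Iff.rfl
  dec_iff := by rintro n g ((a | a) | a) <;> exact Iff.rfl
  edge_iff := by rintro j ((a | a) | a) ((b | b) | b) <;> exact Iff.rfl

end

section

variable (K : Type v) [Field K] (D : Type u)

theorem isPolynomialRealization_comulOpp :
    IsPolynomialRealization (NCK.comulOpp K D) (NCK.component K D) IsUniform
      ForestLike.sum (realizeNCK K) (alphD D) where
  sum_mem _ _ := isUniform_sum
  sum_assoc B B' B'' _ _ _ := isIso_sumAssoc B B' B''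
  graded B _ _ _ hx := by
    rw [← realizeNCKHom_toLinearMap]
    exact isHomogeneous_realizeNCKHom B hx
  doubling _ _ hB hB' x := by
    simp only [← realizeNCKHom_toLinearMap]
    exact theta_realizeNCKHom hB hB' x
  mem := isUniform_alphD
  injective := by
    rw [← realizeNCKHom_toLinearMap]
    exact realizeNCKHom_alphD_injective K D

theorem isPolynomialRealization_comul :
    IsPolynomialRealization (CoalgebraStruct.comul (R := K) (A := NCK K D)) (NCK.component K D)
      IsUniform ForestLike.sumOpp (realizeNCK K) (alphD D) where
  sum_mem _ _ hB hB' := isUniform_comap (isUniform_sum hB' hB)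
  sum_assoc B B' B'' _ _ _ := isIso_sumAssoc_sumOpp B B' B''
  graded B _ _ _ hx := by
    rw [← realizeNCKHom_toLinearMap]
    exact isHomogeneous_realizeNCKHom B hx
  doubling _ _ hB hB' x := by
    simp only [← realizeNCKHom_toLinearMap]
    exact theta_realizeNCKHom_sumOpp hB hB' x
  mem := isUniform_alphD
  injective := by
    rw [← realizeNCKHom_toLinearMap]
    exact realizeNCKHom_alphD_injective K D

theorem range_realizeNCKHom_alphD :
    (realizeNCKHom K (alphD D)).range = ((alphD D).realizeHom K).range := by
  rw [realizeHom_eq_comp isUniform_alphD, AlgHom.range_comp,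
    (AlgHom.range_eq_top (NatHopf.toNCKHom K D)).mpr (NatHopf.toNCK_surjective K D),
    Algebra.map_top]

/-- The realization of decorated planar forests on `alphD D` as an isomorphism onto the image of the
natural Hopf algebra. -/
def realizeNCKEquiv : Coopposite (NCK K D) ≃ₐ[K] ((alphD D).realizeHom K).range :=
  (AlgEquiv.ofInjective (realizeNCKHom K (alphD D)) (realizeNCKHom_alphD_injective K D)).trans
    (Subalgebra.equivOfEq _ _ (range_realizeNCKHom_alphD K D))

theorem coe_realizeNCKEquiv_toNCK (x : NatHopf K (sigD D)) :
    (realizeNCKEquiv K D (NatHopf.toNCK K D x) : NCPoly K (D × ℕ)) = (alphD D).realizeHom K x :=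
  (DFunLike.congr_fun (realizeHom_eq_comp (K := K) isUniform_alphD) x).symm

end

end ForestHopf

end

theorem mainTheorem6_general (K : Type v) [Field K] (D : Type u) :
    IsHopf K (NatHopf K (sigD D)) ∧ IsHopf K (NCK K D) ∧
    (∃ ρ : NatHopf K (sigD D) →ₐ[K] NCPoly K (D × ℕ),
      ρ.toLinearMap = (alphD D).realize K ∧
      ∃ _ : CoalgebraStruct K ρ.range,
        IsHopf K ρ.range ∧
        (∃ π : NatHopf K (sigD D) →ₐc[K] ρ.range, ∀ x, (π x : NCPoly K (D × ℕ)) = ρ x) ∧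
        Nonempty (ρ.range ≃ₐc[K] NCK K D) ∧
        ∃ φ : NCK K D ≃ₐ[K] ρ.range,
          (∀ x, (φ x : NCPoly K (D × ℕ)) = realizeNCK K (alphD D) x) ∧
          (∀ x, CoalgebraStruct.counit (R := K) (φ x) = CoalgebraStruct.counit (R := K) x) ∧
          ∀ x, CoalgebraStruct.comul (R := K) (φ x) =
            TensorProduct.map φ.toLinearMap φ.toLinearMap (NCK.comulOpp K D x)) ∧
    IsPolynomialRealization (NCK.comulOpp K D) (NCK.component K D) IsUniform
      ForestLike.sum (realizeNCK K) (alphD D) ∧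
    IsPolynomialRealization (CoalgebraStruct.comul (R := K) (A := NCK K D)) (NCK.component K D)
      IsUniform ForestLike.sumOpp (realizeNCK K) (alphD D) := by
  refine ⟨(NatHopf.isConilpotent K (sigD D)).isHopf, NCK.isHopf K D,
    ⟨(alphD D).realizeHom K, (alphD D).realizeHom_toLinearMap, ?_⟩,
    isPolynomialRealization_comulOpp K D, isPolynomialRealization_comul K D⟩
  let φ := realizeNCKEquiv K D
  let coalgebraStruct := transportCoalgebraStruct φ
  let Φ : Coopposite (NCK K D) ≃ₐc[K] _ := transportBialgEquiv φ
  let π := Φ.toBialgHom.comp (NatHopf.toNCK K D)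
  obtain ⟨ψ⟩ := NCK.nonempty_coopposite_bialgEquiv K D
  refine ⟨coalgebraStruct, ?_, ⟨π, coe_realizeNCKEquiv_toNCK K D⟩, ⟨Φ.symm.trans ψ⟩, φ,
    DFunLike.congr_fun realizeNCKHom_toLinearMap, counit_transportCoalgebraStruct φ,
    comul_transportCoalgebraStruct φ⟩
  exact (NatHopf.isConilpotent K (sigD D)).isHopf_of_surjective π
    (Φ.surjective.comp (NatHopf.toNCK_surjective K D))

theorem mainTheorem6 (K : Type v) [Field K] [CharZero K] (D : Type u) :
    IsHopf K (NatHopf K (sigD D)) ∧ IsHopf K (NCK K D) ∧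
    (∃ ρ : NatHopf K (sigD D) →ₐ[K] NCPoly K (D × ℕ),
      ρ.toLinearMap = (alphD D).realize K ∧
      ∃ _ : CoalgebraStruct K ρ.range,
        IsHopf K ρ.range ∧
        (∃ π : NatHopf K (sigD D) →ₐc[K] ρ.range, ∀ x, (π x : NCPoly K (D × ℕ)) = ρ x) ∧
        Nonempty (ρ.range ≃ₐc[K] NCK K D) ∧
        ∃ φ : NCK K D ≃ₐ[K] ρ.range,
          (∀ x, (φ x : NCPoly K (D × ℕ)) = realizeNCK K (alphD D) x) ∧
          (∀ x, CoalgebraStruct.counit (R := K) (φ x) = CoalgebraStruct.counit (R := K) x) ∧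
          ∀ x, CoalgebraStruct.comul (R := K) (φ x) =
            TensorProduct.map φ.toLinearMap φ.toLinearMap (NCK.comulOpp K D x)) ∧
    IsPolynomialRealization (NCK.comulOpp K D) (NCK.component K D) IsUniform
      ForestLike.sum (realizeNCK K) (alphD D) ∧
    IsPolynomialRealization (CoalgebraStruct.comul (R := K) (A := NCK K D)) (NCK.component K D)
      IsUniform ForestLike.sumOpp (realizeNCK K) (alphD D) :=
  mainTheorem6_general K D
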